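/- Let $A,C\in\mathbb R^{n\times n}$, $B\in\mathbb R^{n\times m}$, let $*$ denote transposition and $\|\cdot\|$ the Euclidean norm. For a real square matrix $H$ let $\mathscr L^{0}(H)$ and $\mathscr L^{-}(H)$ be the real $H$-invariant subspaces spanned by the generalized eigenvectors of $H$ for eigenvalues with zero, respectively negative, real part, and put $$NO^0(C,A)=\bigcap_{i=0}^{n-1}\ker(CA^i)\cap\mathscr L^0(A).$$ Suppose that $(A,B)$ is controllable and that $NO^0(C,A)\subseteq\ker A$. Let $\widehat E$ be the antistrong solution of the algebraic Riccati equation, that is, the symmetric positive semidefinite matrix with $$\widehat EA+A^*\widehat E-\widehat EBB^*\widehat E+C^*C=0$$ such that all eigenvalues of $A_+:=A-BB^*\widehat E$ have nonpositive real part. Then $\mathbb R^n=NO^0(C,A)\oplus\mathscr L^-(A_+)$; let $\mathbb P_1,\mathbb P_2$ be the corresponding projections onto $NO^0(C,A)$ and onto $\mathscr L^-(A_+)$. For $x_0,x_1,z\in\mathbb R^n$ and $T>2$ let $u^T\in L^2(0,T;\mathbb R^m)$ be an optimal control, with optimal state $x^T$, for $$\min_u\ \frac12\int_0^T\left[\|u(t)\|^2+\|Cx(t)-z\|^2\right]dt,\qquad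 \dot x=Ax+Bu \text{ in }(0,T),\quad x(0)=x_0,\quad x(T)=x_1,$$ and let $\operatorname{argmin}J_s\subseteq\mathbb R^m\times\mathbb R^n$ be the set of minimizers of $J_s(u,x)=\frac12\left[\|u\|^2+\|Cx-z\|^2\right]$ under the constraint $Ax+Bu=0$; it is nonempty. There are $\mu>0$, depending only on $A,B,C$, and $K>0$, depending only on $A,B,C,x_0,x_1,z$ (in particular neither depends on $T$), such that for every $T>2$ and every optimal pair $(u^T,x^T)$ there are $\hat q^T\in\ker(A_+^*)$, $\hat x^T\in\mathscr L^-(A_+)$ and $\hat u^T\in\mathbb R^m$ with $$\hat u^T=\overline u-B^*\widehat E(\hat x^T-\overline x)-B^*\hat q^T\qquad\text{for every }(\overline u,\overline x)\in\operatorname{argmin}J_s$$ (for $z=0$ one may take $(\overline u,\overline x)=(0,0)$, so that $\hat u^T=-B^*\widehat E\hat x^T-B^*\hat q^T$), such that $u^T$ has a continuous representative, again denoted $u^T$, for which, for all $t\in[0,T]$, $$\|u^T(t)-\hat u^T\|+\|\mathbb P_2x^T(t)-\hat x^T\|\le K\left[e^{-\mu t}+e^{-\mu(T-t)}\right],$$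 $$\|u^T(t)-\hat u^T\|+\left\|\mathbb P_1\left[x^T(t)-\left(x_0-tBB^*\hat q^T\right)\right]\right\|\le K\left[e^{-\mu t}+e^{-\mu(T-t)}\right],$$ and moreover $$\operatorname{dist}\left((\hat u^T,\hat x^T),\operatorname{argmin}J_s\right)^2\le\frac KT .$$ -/

import Mathlib

open MeasureTheory Set

namespace Turnpike

/-- `ℝⁿ` with its Euclidean norm. -/
abbrev Vec (n : ℕ) : Type := EuclideanSpace ℝ (Fin n)

/-- The action `x ↦ M x` of a real matrix on Euclidean space. -/
noncomputable abbrev act {m n : ℕ} (M : Matrix (Fin m) (Fin n) ℝ) : Vec n →ₗ[ℝ] Vec m :=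
  Matrix.toEuclideanLin M

/-- The inclusion `ℝⁿ → ℂⁿ`, as a real linear map. -/
noncomputable def complexify (n : ℕ) : Vec n →ₗ[ℝ] (Fin n → ℂ) where
  toFun x := fun i => (x i : ℂ)
  map_add' x y := by ext i; simp
  map_smul' c x := by ext i; simp

/-- The subspace of the `x : ℝⁿ` that are (complex) linear combinations of generalized
eigenvectors of the real matrix `H` for eigenvalues `l ∈ S`. For `S` stable under complex
conjugation this is the real `H`-invariant spectral subspace attached to `S`. -/
noncomputable def spectralSubspace {n : ℕ} (H : Matrix (Fin n) (Fin n) ℝ) (S : Set ℂ) :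
    Submodule ℝ (Vec n) :=
  ((⨆ l ∈ S, Module.End.maxGenEigenspace
      (Matrix.toLin' (H.map (fun r : ℝ => (r : ℂ)))) l).restrictScalars ℝ).comap (complexify n)

/-- The critical subspace `ℒ⁰(H)`: eigenvalues with vanishing real part. -/
noncomputable def critSubspace {n : ℕ} (H : Matrix (Fin n) (Fin n) ℝ) :
    Submodule ℝ (Vec n) :=
  spectralSubspace H {l : ℂ | l.re = 0}

/-- The stable subspace `ℒ⁻(H)`: eigenvalues with negative real part. -/
noncomputable def stableSubspace {n : ℕ} (H : Matrix (Fin n) (Fin n) ℝ) :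
    Submodule ℝ (Vec n) :=
  spectralSubspace H {l : ℂ | l.re < 0}

/-- `NO⁰(C, A) = ⋂_{i < n} ker (C Aⁱ) ∩ ℒ⁰(A)`, the critical unobservable subspace. -/
noncomputable def NO0 {n : ℕ} (C A : Matrix (Fin n) (Fin n) ℝ) : Submodule ℝ (Vec n) :=
  (⨅ i : Fin n, LinearMap.ker (act (C * A ^ (i : ℕ)))) ⊓ critSubspace A

/-- `u ∈ L²(0,T; ℝᵐ)` is a control and `x` is the corresponding (Carathéodory) solution of
`x' = A x + B u` on `[0, T]` with `x(0) = x₀` and `x(T) = x₁`. -/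
structure IsTrajectory {n m : ℕ} (A : Matrix (Fin n) (Fin n) ℝ) (B : Matrix (Fin n) (Fin m) ℝ)
    (T : ℝ) (x₀ x₁ : Vec n) (u : ℝ → Vec m) (x : ℝ → Vec n) : Prop where
  memLp : MemLp u 2 (volume.restrict (Icc 0 T))
  continuousOn : ContinuousOn x (Icc 0 T)
  state_eq : ∀ t ∈ Icc 0 T, x t = x₀ + ∫ s in (0 : ℝ)..t, (act A (x s) + act B (u s))
  endpoint : x T = x₁

/-- Controllability: every state can be steered to every state in every positive time. -/
def IsControllable {n m : ℕ} (A : Matrix (Fin n) (Fin n) ℝ) (B : Matrix (Fin n) (Fin m) ℝ) :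
    Prop :=
  ∀ T : ℝ, 0 < T → ∀ x₀ x₁ : Vec n, ∃ (u : ℝ → Vec m) (x : ℝ → Vec n),
    IsTrajectory A B T x₀ x₁ u x

/-- The cost `Jᵀ = ½ ∫₀ᵀ (‖u‖² + ‖C x - z‖²) dt`. -/
noncomputable def cost {n m : ℕ} (C : Matrix (Fin n) (Fin n) ℝ) (z : Vec n) (T : ℝ)
    (u : ℝ → Vec m) (x : ℝ → Vec n) : ℝ :=
  (1 / 2) * ∫ t in (0 : ℝ)..T, (‖u t‖ ^ 2 + ‖act C (x t) - z‖ ^ 2)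

/-- `(u, x)` is an optimal pair (optimal control and optimal state) of the problem with fixed
endpoints on `[0, T]`. -/
def IsOptimalPair {n m : ℕ} (A : Matrix (Fin n) (Fin n) ℝ) (B : Matrix (Fin n) (Fin m) ℝ)
    (C : Matrix (Fin n) (Fin n) ℝ) (z : Vec n) (T : ℝ) (x₀ x₁ : Vec n)
    (u : ℝ → Vec m) (x : ℝ → Vec n) : Prop :=
  IsTrajectory A B T x₀ x₁ u x ∧
    ∀ (v : ℝ → Vec m) (y : ℝ → Vec n), IsTrajectory A B T x₀ x₁ v y →
      cost C z T u x ≤ cost C z T v y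

/-- `E` is the antistrong solution of the algebraic Riccati equation: symmetric, positive
semidefinite, `E A + Aᵀ E - E B Bᵀ E + Cᵀ C = 0`, and all eigenvalues of `A - B Bᵀ E` have
nonpositive real part. -/
structure IsAntistrongSolution {n m : ℕ} (A : Matrix (Fin n) (Fin n) ℝ)
    (B : Matrix (Fin n) (Fin m) ℝ) (C E : Matrix (Fin n) (Fin n) ℝ) : Prop where
  posSemidef : E.PosSemidef
  riccati : E * A + A.transpose * E - E * B * B.transpose * E + C.transpose * C = 0
  re_nonpos : ∀ l ∈ spectrum ℂ ((A - B * B.transpose * E).map (fun r : ℝ => (r : ℂ))), l.re ≤ 0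

/-- The steady functional `J_s(u, x) = ½ (‖u‖² + ‖C x - z‖²)`; pairs `w = (u, x)` live in
`ℝᵐ × ℝⁿ` with the Euclidean norm. -/
noncomputable def steadyCost {n m : ℕ} (C : Matrix (Fin n) (Fin n) ℝ) (z : Vec n)
    (w : WithLp 2 (Vec m × Vec n)) : ℝ :=
  (1 / 2) * (‖w.fst‖ ^ 2 + ‖act C w.snd - z‖ ^ 2)

/-- `argmin J_s` under the constraint `0 = A x + B u`. -/
def steadyArgmin {n m : ℕ} (A : Matrix (Fin n) (Fin n) ℝ) (B : Matrix (Fin n) (Fin m) ℝ)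
    (C : Matrix (Fin n) (Fin n) ℝ) (z : Vec n) : Set (WithLp 2 (Vec m × Vec n)) :=
  {w | act A w.snd + act B w.fst = 0 ∧
    ∀ w' : WithLp 2 (Vec m × Vec n), act A w'.snd + act B w'.fst = 0 →
      steadyCost C z w ≤ steadyCost C z w'}

end Turnpike

namespace Turnpike

open scoped RealInnerProductSpace InnerProductSpace

/-! The proof decouples the Hamiltonian system by the Riccati matrix and reads the turnpike off an
explicit boundary value problem. Fix a steady minimizer `(ū, x̄)` with Lagrange multiplier `p₀`, put
`y = x - x̄` and take the costate in the form `p = p₀ + E y + r`. The Riccati equation turns the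
optimality system into `y' = A₊ y - B B* r`, `r' = -A₊* r`, so `r(t) = exp((T - t) A₊)* q`. The
terminal condition is a linear equation for `q` whose matrix is the controllability Gramian of `(A₊,
B)`. It is coercive uniformly in `T ≥ 1`, so `q` is bounded independently of `T`
(`exists_gramian_coercive`, `exists_boundary_value_solution`). By convexity every optimal pair
agrees with the one so constructed (`IsOptimalPair.eq_of_hamiltonian`).

The spectral input is that `A₊` has no imaginary eigenvalue except possibly a semisimple `0`. It
comes from the dissipation identity `inner_riccati`: motions of `A₊` without dissipation have zero
feedback and zero output, hence are motions of `A` in `NO⁰(C, A)`, where `A` vanishes by hypothesis.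
Thus `ker A₊ = NO⁰`, `range A₊ = ℒ⁻(A₊)`, and these are complementary, with projections `P` and `Q`.

Away from `T`, `r` is exponentially close to `q' = P* q`. Hence `Q y` relaxes to the equilibrium of
the stable part forced by `-B B* q'`, while `P y` drifts linearly with velocity `-P B B* q'`. Since
`y(T)` is prescribed, this drift is bounded over time `T`, which makes `‖B* q'‖² = ⟪q, P B B* P* q⟫`
of order `1 / T`. The distance to the steady minimizers is controlled by `‖B* q'‖`. -/

/-- Integration by parts for a primitive of a merely integrable function against a
continuously differentiable one. -/
theorem integral_inner_deriv_add_inner {n : ℕ} {T : ℝ} (hT : 0 ≤ T) {p p' d g : ℝ → Vec n}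
    {d₀ : Vec n} (hp : ∀ t, HasDerivAt p (p' t) t) (hp' : Continuous p')
    (hg : IntervalIntegrable g volume 0 T)
    (hd : ∀ t ∈ Icc 0 T, d t = d₀ + ∫ s in (0 : ℝ)..t, g s) :
    ∫ t in (0 : ℝ)..T, (⟪p' t, d t⟫_ℝ + ⟪p t, g t⟫_ℝ) = ⟪p T, d T⟫_ℝ - ⟪p 0, d 0⟫_ℝ := by
  have hgi : ∀ i, IntervalIntegrable (fun t => g t i) volume 0 T := fun i =>
    ⟨(EuclideanSpace.proj (𝕜 := ℝ) i).integrable_comp hg.1,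
      (EuclideanSpace.proj (𝕜 := ℝ) i).integrable_comp hg.2⟩
  have hpi : ∀ i t, HasDerivAt (fun t => p t i) (p' t i) t := fun i t =>
    ((EuclideanSpace.proj (𝕜 := ℝ) i).hasFDerivAt.comp_hasDerivAt t (hp t))
  have hp'i : ∀ i, Continuous (fun t => p' t i) := fun i =>
    (EuclideanSpace.proj (𝕜 := ℝ) i).continuous.comp hp'
  -- `d` is only known on `[0, T]`; `D` is a globally defined primitive that can be differentiated
  -- almost everywhere.
  let D : Fin n → ℝ → ℝ := fun i t => d₀ i + ∫ s in (0 : ℝ)..t, g s i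
  have hD : ∀ i, ∀ t ∈ Icc 0 T, d t i = D i t := by
    intro i t ht
    have hgt : IntervalIntegrable g volume 0 t :=
      hg.mono_set (by rw [uIcc_of_le ht.1, uIcc_of_le hT]; exact Icc_subset_Icc_right ht.2)
    have := (EuclideanSpace.proj i : Vec n →L[ℝ] ℝ).intervalIntegral_comp_comm hgt
    rw [hd t ht, PiLp.add_apply]
    exact congrArg (d₀ i + ·) this.symm
  have key : ∀ i, IntervalIntegrable (fun t => p' t i * d t i + p t i * g t i) volume 0 T ∧
      ∫ t in (0 : ℝ)..T, (p' t i * d t i + p t i * g t i) = p T i * d T i - p 0 i * d 0 i := by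
    intro i
    have hAp : AbsolutelyContinuousOnInterval (fun t => p t i) 0 T := by
      refine (ContDiff.contDiffOn ?_).absolutelyContinuousOnInterval
      rw [contDiff_one_iff_deriv]
      refine ⟨fun t => (hpi i t).differentiableAt, ?_⟩
      rw [show deriv (fun t => p t i) = fun t => p' t i from funext fun t => (hpi i t).deriv]
      exact hp'i i
    have hAd : AbsolutelyContinuousOnInterval (D i) 0 T := by
      have h1 := (hgi i).absolutelyContinuousOnInterval_intervalIntegral (c := 0) (by simp)
      have h2 : AbsolutelyContinuousOnInterval (fun _ : ℝ => d₀ i) 0 T :=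
        (contDiff_const (n := 1)).contDiffOn.absolutelyContinuousOnInterval
      exact h2.add h1
    have hderiv : ∀ᵐ t, t ∈ uIcc 0 T → deriv (D i) t = g t i := by
      filter_upwards [(hgi i).ae_hasDerivAt_integral] with t ht htT
      exact ((ht htT 0 (by simp)).const_add (d₀ i)).deriv
    have hDc : ContinuousOn (D i) (uIcc 0 T) := hAd.continuousOn
    have hdc : ContinuousOn (fun t => d t i) (uIcc 0 T) := hDc.congr (by
      rw [uIcc_of_le hT]; exact hD i)
    refine ⟨((hp'i i).continuousOn.mul hdc).intervalIntegrable.add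
      ((hgi i).continuousOn_mul (hAp.continuousOn)), ?_⟩
    have := hAp.integral_deriv_mul_eq_sub hAd
    rw [hD i T (by simp [hT]), hD i 0 (by simp [hT]), ← this]
    refine intervalIntegral.integral_congr_ae ?_
    filter_upwards [hderiv] with t ht htT
    have htT' := uIoc_subset_uIcc htT
    rw [ht htT', (hpi i t).deriv, hD i t (by rwa [uIcc_of_le hT] at htT')]
  have h1 : ∀ t, ⟪p' t, d t⟫_ℝ + ⟪p t, g t⟫_ℝ = ∑ i, (p' t i * d t i + p t i * g t i) := by
    intro t
    simp only [PiLp.inner_apply, Finset.sum_add_distrib, RCLike.inner_apply, conj_trivial, mul_comm]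
  simp only [h1]
  rw [intervalIntegral.integral_finsetSum fun i _ => (key i).1]
  simp only [PiLp.inner_apply, ← Finset.sum_sub_distrib]
  refine Finset.sum_congr rfl fun i _ => ?_
  rw [(key i).2]
  simp [mul_comm]

/-! ### The one-parameter group of a bounded operator. -/

section Exponential

variable {F : Type*} [NormedAddCommGroup F] [NormedSpace ℝ F]

/-- The one-parameter group `t ↦ exp (t M)`. -/
noncomputable def flow (M : F →L[ℝ] F) (t : ℝ) : F →L[ℝ] F := NormedSpace.exp (t • M)

@[simp] theorem flow_zero (M : F →L[ℝ] F) : flow M 0 = 1 := by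
  simp [flow]

variable [CompleteSpace F]

theorem hasDerivAt_flow (M : F →L[ℝ] F) (t : ℝ) : HasDerivAt (flow M) (M * flow M t) t :=
  hasDerivAt_exp_smul_const' M t

theorem hasDerivAt_flow' (M : F →L[ℝ] F) (t : ℝ) : HasDerivAt (flow M) (flow M t * M) t :=
  hasDerivAt_exp_smul_const M t

theorem continuous_flow (M : F →L[ℝ] F) : Continuous (flow M) :=
  continuous_iff_continuousAt.2 fun t => (hasDerivAt_flow M t).continuousAt

theorem flow_add (M : F →L[ℝ] F) (s t : ℝ) : flow M (s + t) = flow M s * flow M t := by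
  have : Commute (s • M) (t • M) := ((Commute.refl M).smul_left s).smul_right t
  let _ : NormedAlgebra ℚ (F →L[ℝ] F) := NormedAlgebra.restrictScalars ℚ ℝ _
  rw [flow, add_smul, NormedSpace.exp_add_of_commute this, flow, flow]

/-- `flow M (c - s) (y s)` along a curve `y` with `y' = M y + f`. -/
theorem hasDerivAt_flow_sub_apply (M : F →L[ℝ] F) (c : ℝ) {y f : ℝ → F} {s : ℝ}
    (hy : HasDerivAt y (M (y s) + f s) s) :
    HasDerivAt (fun s => flow M (c - s) (y s)) (flow M (c - s) (f s)) s := by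
  have h1 : HasDerivAt (fun s => flow M (c - s)) (-(flow M (c - s) * M)) s := by
    have := (hasDerivAt_flow' M (c - s)).scomp s ((hasDerivAt_id s).const_sub c)
    rwa [neg_one_smul] at this
  convert h1.clm_apply hy using 1
  simp

theorem flow_comp_of_comp_eq_zero {M P : F →L[ℝ] F} (h : M * P = 0) (t : ℝ) :
    flow M t * P = P := by
  have hd : ∀ t, HasDerivAt (fun t => flow M t * P) 0 t := fun t => by
    simpa [mul_assoc, h] using (hasDerivAt_flow' M t).mul_const P
  have := is_const_of_deriv_eq_zero (fun t => (hd t).differentiableAt) (fun t => (hd t).deriv) t 0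
  simpa using this

end Exponential

theorem adjoint_flow {n : ℕ} (M : Vec n →L[ℝ] Vec n) (t : ℝ) :
    (flow M t).adjoint = flow M.adjoint t := by
  simp only [flow, ← ContinuousLinearMap.star_eq_adjoint, NormedSpace.star_exp, star_smul]
  simp

/-- A mean value inequality that replaces every estimate of a variation-of-constants integral below.
-/
theorem norm_le_add_exp_of_norm_deriv_le {F : Type*} [NormedAddCommGroup F] [NormedSpace ℝ F]
    {f f' : ℝ → F} {t a c : ℝ} (ht : 0 ≤ t) (ha : 0 < a) (hf : ∀ s, HasDerivAt f (f' s) s)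
    (hc : 0 ≤ c) (hbound : ∀ s ∈ Ico 0 t, ‖f' s‖ ≤ c * Real.exp (a * s)) :
    ‖f t‖ ≤ ‖f 0‖ + c / a * Real.exp (a * t) := by
  have hB : ∀ s : ℝ, HasDerivAt (fun s => ‖f 0‖ + c / a * Real.exp (a * s))
      (c * Real.exp (a * s)) s := by
    intro s
    have h1 : HasDerivAt (fun s => Real.exp (a * s)) (Real.exp (a * s) * a) s := by
      simpa using ((hasDerivAt_id s).const_mul a).exp
    refine ((h1.const_mul (c / a)).const_add ‖f 0‖).congr_deriv ?_
    rw [mul_comm (Real.exp _), ← mul_assoc, div_mul_cancel₀ _ ha.ne']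
  exact image_norm_le_of_norm_deriv_right_le_deriv_boundary (a := 0) (b := t)
    (fun s _ => (hf s).continuousAt.continuousWithinAt) (fun s _ => (hf s).hasDerivWithinAt)
    (by simp; positivity) hB hbound ⟨ht, le_rfl⟩

/-! ### Exponential decay on the stable spectral subspace. -/

section Decay

variable {n : ℕ}

/-- Induction on the height of the generalized eigenvector: `exp(-l s) exp(s N) v` has derivative
`exp(-l s) exp(s N) (N - l) v`, already controlled by the previous step. Since `μ < -Re l` strictly,
the integrated bound grows like `exp(a t)` with `a > 0`, and no polynomial factor appears. -/
theorem exists_decay_of_pow_eq_zero {F : Type*} [NormedAddCommGroup F] [NormedSpace ℂ F]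
    [NormedSpace ℝ F] [IsScalarTower ℝ ℂ F] [CompleteSpace F] (N : F →L[ℂ] F) {l : ℂ} {μ : ℝ} (hl : μ < -l.re) (k : ℕ) :
    ∀ v : F, ((N - l • (1 : F →L[ℂ] F)) ^ k) v = 0 → ∃ c : ℝ, ∀ t : ℝ, 0 ≤ t →
      ‖NormedSpace.exp ((t : ℂ) • N) v‖ ≤ c * Real.exp (-μ * t) := by
  induction k with
  | zero =>
    intro v hv
    have : v = 0 := by simpa using hv
    exact ⟨0, fun t _ => by simp [this]⟩
  | succ k ih =>
    intro v hv
    obtain ⟨c, hc⟩ := ih ((N - l • (1 : F →L[ℂ] F)) v) (by rw [pow_succ] at hv; exact hv)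
    set w := (N - l • (1 : F →L[ℂ] F)) v with hw
    set a : ℝ := -l.re - μ with ha
    have ha0 : 0 < a := by linarith
    have hderiv : ∀ s : ℝ, HasDerivAt
        (fun s : ℝ => Complex.exp (-l * s) • NormedSpace.exp ((s : ℂ) • N) v)
        (Complex.exp (-l * s) • NormedSpace.exp ((s : ℂ) • N) w) s := by
      intro s
      have h1 : HasDerivAt (fun z : ℂ => NormedSpace.exp (z • N) v)
          (NormedSpace.exp ((s : ℂ) • N) (N v)) (s : ℂ) := by
        simpa using (hasDerivAt_exp_smul_const N (s : ℂ)).clm_apply (hasDerivAt_const (s : ℂ) v)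
      have h2 : HasDerivAt (fun z : ℂ => Complex.exp (-l * z)) (Complex.exp (-l * s) * -l) (s : ℂ) := by
        simpa using ((hasDerivAt_id (s : ℂ)).const_mul (-l)).cexp
      have h3 := (h2.smul h1).scomp s Complex.ofRealCLM.hasDerivAt
      refine h3.congr_deriv ?_
      rw [hw]
      simp [smul_smul, mul_comm, sub_eq_add_neg]
    have hnorm : ∀ s : ℝ, ‖Complex.exp (-l * s)‖ = Real.exp (-l.re * s) := by
      intro s; rw [Complex.norm_exp]; simp
    refine ⟨‖v‖ + |c| / a, fun t ht => ?_⟩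
    have hbd := norm_le_add_exp_of_norm_deriv_le ht ha0 hderiv (abs_nonneg c) fun s hs => by
      rw [norm_smul, hnorm]
      calc _ ≤ Real.exp (-l.re * s) * (|c| * Real.exp (-μ * s)) := by
            gcongr
            exact (hc s hs.1).trans (by gcongr; exact le_abs_self c)
        _ = |c| * Real.exp (a * s) := by
            rw [mul_left_comm, ← Real.exp_add]; congr 2; rw [ha]; ring
    simp only [Complex.ofReal_zero, mul_zero, Complex.exp_zero, one_smul] at hbd
    rw [show NormedSpace.exp ((0 : ℂ) • N) v = v by
      have h : (0 : ℂ) • N = 0 := by ext; simp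
      rw [h, NormedSpace.exp_zero]; rfl] at hbd
    rw [norm_smul, hnorm] at hbd
    have h4 : ‖v‖ + |c| / a * Real.exp (a * t) ≤ (‖v‖ + |c| / a) * Real.exp (a * t) := by
      have : 1 ≤ Real.exp (a * t) := Real.one_le_exp (by positivity)
      nlinarith [norm_nonneg v]
    have h5 : ‖NormedSpace.exp ((t : ℂ) • N) v‖ =
        Real.exp (l.re * t) * (Real.exp (-l.re * t) * ‖NormedSpace.exp ((t : ℂ) • N) v‖) := by
      rw [← mul_assoc, ← Real.exp_add]; simp
    rw [h5]
    calc _ ≤ Real.exp (l.re * t) * ((‖v‖ + |c| / a) * Real.exp (a * t)) := by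
          exact mul_le_mul_of_nonneg_left (hbd.trans h4) (Real.exp_pos _).le
      _ = (‖v‖ + |c| / a) * Real.exp (-μ * t) := by
          rw [mul_left_comm, ← Real.exp_add]; congr 2; rw [ha]; ring

/-- The continuous linear map attached to a real matrix. -/
noncomputable abbrev actL {m n : ℕ} (M : Matrix (Fin m) (Fin n) ℝ) : Vec n →L[ℝ] Vec m :=
  LinearMap.toContinuousLinearMap (act M)

theorem complexify_act (H : Matrix (Fin n) (Fin n) ℝ) (x : Vec n) :
    complexify n (act H x) =
      Matrix.toLin' (H.map (fun r : ℝ => (r : ℂ))) (complexify n x) := by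
  ext i
  simp [complexify, Matrix.toLpLin_apply, Matrix.mulVec, dotProduct]

/-- The curve `s ↦ exp((t - s) N) (c (exp(s H) x))` is constant; compare its values at `0` and `t`.
-/
theorem complexify_flow (H : Matrix (Fin n) (Fin n) ℝ) (t : ℝ) (x : Vec n) :
    complexify n (flow (actL H) t x) =
      NormedSpace.exp ((t : ℂ) • LinearMap.toContinuousLinearMap
        (Matrix.toLin' (H.map (fun r : ℝ => (r : ℂ))))) (complexify n x) := by
  set N := LinearMap.toContinuousLinearMap (Matrix.toLin' (H.map (fun r : ℝ => (r : ℂ))))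
  set c : Vec n →L[ℝ] (Fin n → ℂ) := LinearMap.toContinuousLinearMap (complexify n)
  have hc : ∀ x, c (actL H x) = N (c x) := complexify_act H
  have h1 : ∀ s : ℝ, HasDerivAt (fun s : ℝ => NormedSpace.exp (((t - s : ℝ) : ℂ) • N))
      (-(NormedSpace.exp (((t - s : ℝ) : ℂ) • N) * N)) s := by
    intro s
    have h : HasDerivAt (fun s : ℝ => ((t - s : ℝ) : ℂ)) (-1) s := by
      simpa using ((hasDerivAt_id s).const_sub t).ofReal_comp
    have := (hasDerivAt_exp_smul_const N ((t - s : ℝ) : ℂ)).scomp s h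
    rwa [neg_one_smul] at this
  have h2 : ∀ s : ℝ, HasDerivAt (fun s => c (flow (actL H) s x)) (N (c (flow (actL H) s x))) s := by
    intro s
    have := c.hasFDerivAt.comp_hasDerivAt s
      ((hasDerivAt_flow (actL H) s).clm_apply (hasDerivAt_const s x))
    refine this.congr_deriv ?_
    rw [map_zero, add_zero]
    exact hc _
  have h3 : ∀ s : ℝ, HasDerivAt (fun s : ℝ => NormedSpace.exp (((t - s : ℝ) : ℂ) • N)
      (c (flow (actL H) s x))) 0 s := by
    intro s
    have := (((ContinuousLinearMap.restrictScalarsL ℂ (Fin n → ℂ) (Fin n → ℂ) ℝ ℝ).hasFDerivAt).comp_hasDerivAt s (h1 s)).clm_apply (h2 s)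
    simpa [Function.comp_def] using this
  have := is_const_of_deriv_eq_zero (fun t => (h3 t).differentiableAt) (fun t => (h3 t).deriv) t 0
  simp only [sub_self, Complex.ofReal_zero, sub_zero, flow_zero] at this
  have h0 : ∀ y, NormedSpace.exp ((0 : ℂ) • N) y = y := fun y => by
    have h : (0 : ℂ) • N = 0 := by ext; simp
    rw [h, NormedSpace.exp_zero]; rfl
  exact (h0 _).symm.trans this

theorem exists_norm_flow_comp_le (H : Matrix (Fin n) (Fin n) ℝ) (P : Vec n →L[ℝ] Vec n)
    (hP : ∀ x, P x ∈ stableSubspace H) :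
    ∃ μ : ℝ, 0 < μ ∧ ∃ k : ℝ, 0 < k ∧ ∀ t : ℝ, 0 ≤ t →
      ‖flow (actL H) t * P‖ ≤ k * Real.exp (-μ * t) := by
  set Nl : Module.End ℂ (Fin n → ℂ) := Matrix.toLin' (H.map (fun r : ℝ => (r : ℂ))) with hNl
  set N := LinearMap.toContinuousLinearMap Nl with hN
  -- Half the spectral gap: finitely many eigenvalues lie in the open left half plane, and halving
  -- keeps the inequality strict.
  obtain ⟨μ, hμ, hμl⟩ : ∃ μ : ℝ, 0 < μ ∧ ∀ l : ℂ, Nl.HasEigenvalue l → l.re < 0 → μ < -l.re := by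
    have hfin : Set.Finite {l : ℂ | Nl.HasEigenvalue l ∧ l.re < 0} :=
      Nl.finite_hasEigenvalue.subset fun l h => h.1
    obtain ⟨b, hb⟩ := (hfin.image fun l : ℂ => l.re).bddAbove
    by_cases hne : {l : ℂ | Nl.HasEigenvalue l ∧ l.re < 0}.Nonempty
    · obtain ⟨l₀, hl₀, hmax⟩ := Set.exists_max_image _ (fun l : ℂ => l.re) hfin hne
      refine ⟨-l₀.re / 2, by linarith [hl₀.2], fun l h1 h2 => ?_⟩
      have := hmax l ⟨h1, h2⟩
      linarith [hl₀.2]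
    · refine ⟨1, one_pos, fun l h1 h2 => (hne ⟨l, h1, h2⟩).elim⟩
  -- The vectors decaying at rate `μ` form a complex subspace, so it suffices to put each
  -- generalized eigenspace inside it.
  let D : Submodule ℂ (Fin n → ℂ) :=
    { carrier := {v | ∃ c : ℝ, ∀ t : ℝ, 0 ≤ t →
        ‖NormedSpace.exp ((t : ℂ) • N) v‖ ≤ c * Real.exp (-μ * t)}
      zero_mem' := ⟨0, fun t _ => by simp⟩
      add_mem' := by
        rintro v w ⟨c, hc⟩ ⟨d, hd⟩
        refine ⟨c + d, fun t ht => ?_⟩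
        rw [map_add, add_mul]
        exact (norm_add_le _ _).trans (add_le_add (hc t ht) (hd t ht))
      smul_mem' := by
        rintro a v ⟨c, hc⟩
        refine ⟨‖a‖ * c, fun t ht => ?_⟩
        rw [map_smul, norm_smul, mul_assoc]
        exact mul_le_mul_of_nonneg_left (hc t ht) (norm_nonneg _) }
  have hsup : (⨆ l ∈ {l : ℂ | l.re < 0}, Module.End.maxGenEigenspace Nl l) ≤ D := by
    refine iSup₂_le fun l hl v hv => ?_
    by_cases hev : Nl.HasEigenvalue l
    · obtain ⟨k, hk⟩ := (Module.End.mem_maxGenEigenspace _ _ _).1 hv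
      refine exists_decay_of_pow_eq_zero N (hμl l hev hl) k v ?_
      rw [← hk]
      have : ∀ k w, ((N - l • (1 : (Fin n → ℂ) →L[ℂ] (Fin n → ℂ))) ^ k) w =
          ((Nl - l • 1) ^ k) w := by
        intro k
        induction k with
        | zero => exact fun _ => rfl
        | succ k ih => intro w; rw [pow_succ, pow_succ]; exact ih _
      exact this k v
    · rw [Module.End.hasEigenvalue_iff, not_not, Module.End.eigenspace_def,
        LinearMap.ker_eq_bot] at hev
      obtain ⟨k, hk⟩ := (Module.End.mem_maxGenEigenspace _ _ _).1 hv
      have : v = 0 := by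
        refine (hev.iterate k) ?_
        rw [← Module.End.coe_pow, map_zero]
        exact hk
      rw [this]
      exact D.zero_mem
  have hcol : ∀ x, ∃ c : ℝ, ∀ t : ℝ, 0 ≤ t → ‖flow (actL H) t (P x)‖ ≤ c * Real.exp (-μ * t) := by
    intro x
    obtain ⟨c, hc⟩ := hsup (hP x)
    obtain ⟨a, ha, hca⟩ : ∃ a : ℝ, 0 ≤ a ∧ ∀ y : Vec n, ‖y‖ ≤ a * ‖complexify n y‖ := by
      refine ⟨∑ i : Fin n, 1, by positivity, fun y => ?_⟩
      calc ‖y‖ = ‖∑ i, EuclideanSpace.single i (y i)‖ := by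
            congr 1; ext i; simp [Pi.single_apply]
        _ ≤ ∑ i, ‖y i‖ := by
            refine (norm_sum_le _ _).trans (le_of_eq ?_)
            simp
        _ ≤ ∑ i : Fin n, ‖complexify n y‖ := by
            refine Finset.sum_le_sum fun i _ => ?_
            have := norm_le_pi_norm (complexify n y) i
            simpa [complexify] using this
        _ = _ := by simp
    refine ⟨a * c, fun t ht => (hca _).trans ?_⟩
    rw [complexify_flow, mul_assoc]
    exact mul_le_mul_of_nonneg_left (hc t ht) ha
  choose c hc using fun i => hcol (EuclideanSpace.single i 1)
  refine ⟨μ, hμ, ∑ i, |c i| + 1, by positivity, fun t ht => ?_⟩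
  refine ContinuousLinearMap.opNorm_le_bound _ (by positivity) fun x => ?_
  have hx : x = ∑ i, x i • EuclideanSpace.single i (1 : ℝ) := by
    ext j; simp [Pi.single_apply]
  calc ‖(flow (actL H) t * P) x‖ = ‖∑ i, x i • flow (actL H) t (P (EuclideanSpace.single i 1))‖ := by
        conv_lhs => rw [hx]
        simp
    _ ≤ ∑ i, ‖x i‖ * (|c i| * Real.exp (-μ * t)) := by
        refine (norm_sum_le _ _).trans (Finset.sum_le_sum fun i _ => ?_)
        rw [norm_smul]
        gcongr
        exact (hc i t ht).trans (by gcongr; exact le_abs_self _)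
    _ ≤ ∑ i, ‖x‖ * (|c i| * Real.exp (-μ * t)) := by
        gcongr with i
        exact PiLp.norm_apply_le x i
    _ = (∑ i, |c i|) * Real.exp (-μ * t) * ‖x‖ := by
        rw [← Finset.mul_sum, ← Finset.sum_mul, mul_comm]
    _ ≤ _ := by
        gcongr; linarith

end Decay

/-! ### Spectral structure of the closed loop matrix. -/

section Algebra

theorem act_mul {k m n : ℕ} (M : Matrix (Fin k) (Fin m) ℝ) (N : Matrix (Fin m) (Fin n) ℝ)
    (x : Vec n) : act (M * N) x = act M (act N x) := by
  simp [act, Matrix.toLpLin_apply, Matrix.mulVec_mulVec]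

theorem act_add {m n : ℕ} (M N : Matrix (Fin m) (Fin n) ℝ) : act (M + N) = act M + act N :=
  map_add Matrix.toEuclideanLin M N

theorem act_sub {m n : ℕ} (M N : Matrix (Fin m) (Fin n) ℝ) : act (M - N) = act M - act N :=
  map_sub Matrix.toEuclideanLin M N

theorem act_zero {m n : ℕ} : act (0 : Matrix (Fin m) (Fin n) ℝ) = 0 :=
  map_zero Matrix.toEuclideanLin

theorem inner_act_transpose {m n : ℕ} (M : Matrix (Fin m) (Fin n) ℝ) (x : Vec m) (y : Vec n) :
    ⟪act M.transpose x, y⟫_ℝ = ⟪x, act M y⟫_ℝ := by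
  rw [← Matrix.conjTranspose_eq_transpose_of_trivial, act,
    Matrix.toEuclideanLin_conjTranspose_eq_adjoint, LinearMap.adjoint_inner_left]

theorem inner_act_left {m n : ℕ} (M : Matrix (Fin m) (Fin n) ℝ) (x : Vec n) (y : Vec m) :
    ⟪act M x, y⟫_ℝ = ⟪x, act M.transpose y⟫_ℝ := by
  rw [real_inner_comm, ← inner_act_transpose, real_inner_comm]

/-- The complexification of the action of a real matrix. -/
noncomputable abbrev cact {n : ℕ} (H : Matrix (Fin n) (Fin n) ℝ) : Module.End ℂ (Fin n → ℂ) :=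
  Matrix.toLin' (H.map (fun r : ℝ => (r : ℂ)))

theorem exists_eq_complexify_add {n : ℕ} (y : Fin n → ℂ) :
    ∃ a b : Vec n, y = complexify n a + Complex.I • complexify n b := by
  refine ⟨WithLp.toLp 2 fun i => (y i).re, WithLp.toLp 2 fun i => (y i).im, ?_⟩
  ext i
  simp [complexify, mul_comm Complex.I, Complex.re_add_im]

theorem complexify_add_inj {n : ℕ} {a b a' b' : Vec n}
    (h : complexify n a + Complex.I • complexify n b =
      complexify n a' + Complex.I • complexify n b') : a = a' ∧ b = b' := by
  constructor
  · ext i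
    simpa [complexify] using congrArg Complex.re (congrFun h i)
  · ext i
    simpa [complexify] using congrArg Complex.im (congrFun h i)

theorem cact_complexify_add {n : ℕ} (H : Matrix (Fin n) (Fin n) ℝ) (a b : Vec n) :
    cact H (complexify n a + Complex.I • complexify n b) =
      complexify n (act H a) + Complex.I • complexify n (act H b) := by
  rw [map_add, map_smul, complexify_act, complexify_act]

variable {n m : ℕ} {A : Matrix (Fin n) (Fin n) ℝ} {B : Matrix (Fin n) (Fin m) ℝ}
  {C E : Matrix (Fin n) (Fin n) ℝ}

theorem mem_NO0_iff {x : Vec n} :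
    x ∈ NO0 C A ↔ (∀ i : Fin n, act (C * A ^ (i : ℕ)) x = 0) ∧ x ∈ critSubspace A := by
  simp [NO0]

theorem act_output_eq_zero_of_mem_NO0 {x : Vec n} (hx : x ∈ NO0 C A) : act C x = 0 := by
  rcases n with _ | n
  · exact Subsingleton.elim _ _
  · simpa using (mem_NO0_iff.1 hx).1 0

theorem act_mul_pow_eq_zero (C : Matrix (Fin n) (Fin n) ℝ) {W : Submodule ℝ (Vec n)}
    (hA : ∀ x ∈ W, act A x ∈ W) (hC : ∀ x ∈ W, act C x = 0) (i : ℕ) {x : Vec n} (hx : x ∈ W) :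
    act (C * A ^ i) x = 0 := by
  have : ∀ i : ℕ, act (A ^ i) x ∈ W := by
    intro i
    induction i with
    | zero => simpa [act] using hx
    | succ i ih => rw [pow_succ', act_mul]; exact hA _ ih
  rw [act_mul]
  exact hC _ (this i)

/-- `a + i b` and `a - i b` are in the eigenspaces of `A` for `i r` and `-i r`, and `a` is their
mean. -/
theorem mem_critSubspace_of_rotation {a b : Vec n} {r : ℝ} (ha : act A a = -(r • b))
    (hb : act A b = r • a) : a ∈ critSubspace A := by
  have key : ∀ (c : Vec n) (s : ℝ), act A a = -(s • c) → act A c = s • a →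
      complexify n a + Complex.I • complexify n c ∈
        (⨆ l ∈ {l : ℂ | l.re = 0}, Module.End.maxGenEigenspace (cact A) l) := by
    intro c s h1 h2
    refine Submodule.mem_iSup_of_mem ((s : ℂ) * Complex.I)
      (Submodule.mem_iSup_of_mem (by simp) ?_)
    refine (Module.End.mem_maxGenEigenspace _ _ _).2 ⟨1, ?_⟩
    rw [pow_one, LinearMap.sub_apply, cact_complexify_add, h1, h2]
    ext i
    simp [complexify]
    linear_combination (-(s : ℂ) * (c i : ℂ)) * Complex.I_sq
  have h1 := key b r ha hb
  have h2 := key (-b) (-r) (by simpa using ha) (by simpa using hb)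
  have h3 := Submodule.smul_mem _ (2⁻¹ : ℂ) (Submodule.add_mem _ h1 h2)
  show complexify n a ∈ (⨆ l ∈ {l : ℂ | l.re = 0}, Module.End.maxGenEigenspace (cact A) l)
  convert h3 using 1
  ext i
  simp [complexify]
  ring

theorem mem_NO0_of_rotation {a b : Vec n} {r : ℝ} (ha : act A a = -(r • b))
    (hb : act A b = r • a) (hCa : act C a = 0) (hCb : act C b = 0) : a ∈ NO0 C A := by
  refine mem_NO0_iff.2 ⟨fun i => ?_, mem_critSubspace_of_rotation ha hb⟩
  refine act_mul_pow_eq_zero (W := Submodule.span ℝ {a, b}) C ?_ ?_ i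
    (Submodule.subset_span (by simp))
  · intro x hx
    obtain ⟨s, t, rfl⟩ := Submodule.mem_span_pair.1 hx
    rw [map_add, map_smul, map_smul, ha, hb]
    exact Submodule.mem_span_pair.2 ⟨t * r, -(s * r), by module⟩
  · intro x hx
    obtain ⟨s, t, rfl⟩ := Submodule.mem_span_pair.1 hx
    rw [map_add, map_smul, map_smul, hCa, hCb]
    simp

theorem mem_NO0_of_act_eq_zero {x : Vec n} (hA : act A x = 0) (hC : act C x = 0) :
    x ∈ NO0 C A :=
  mem_NO0_of_rotation (r := 0) (b := x) (by simpa using hA) (by simpa using hA) hC hC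

/-- A generalized kernel vector of height two; with `NO⁰ ⊆ ker A` this rules out Jordan blocks. -/
theorem mem_NO0_of_act_act_eq_zero {x : Vec n} (hA : act A (act A x) = 0) (hC : act C x = 0)
    (hCA : act C (act A x) = 0) : x ∈ NO0 C A := by
  refine mem_NO0_iff.2 ⟨fun i => ?_, ?_⟩
  · refine act_mul_pow_eq_zero (W := Submodule.span ℝ {x, act A x}) C ?_ ?_ i
      (Submodule.subset_span (by simp))
    · intro y hy
      obtain ⟨s, t, rfl⟩ := Submodule.mem_span_pair.1 hy
      rw [map_add, map_smul, map_smul, hA]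
      exact Submodule.mem_span_pair.2 ⟨0, s, by module⟩
    · intro y hy
      obtain ⟨s, t, rfl⟩ := Submodule.mem_span_pair.1 hy
      rw [map_add, map_smul, map_smul, hC, hCA]
      simp
  · show complexify n x ∈ (⨆ l ∈ {l : ℂ | l.re = 0}, Module.End.maxGenEigenspace (cact A) l)
    refine Submodule.mem_iSup_of_mem 0 (Submodule.mem_iSup_of_mem (by simp) ?_)
    refine (Module.End.mem_maxGenEigenspace _ _ _).2 ⟨2, ?_⟩
    rw [zero_smul, sub_zero, pow_two, Module.End.mul_apply, ← complexify_act, ← complexify_act, hA,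
      map_zero]

/-- The closed loop matrix `A₊ = A - B Bᵀ E`. -/
abbrev closedLoop (A : Matrix (Fin n) (Fin n) ℝ) (B : Matrix (Fin n) (Fin m) ℝ)
    (E : Matrix (Fin n) (Fin n) ℝ) : Matrix (Fin n) (Fin n) ℝ :=
  A - B * B.transpose * E

theorem act_closedLoop (x : Vec n) :
    act (closedLoop A B E) x = act A x - act B (act (B.transpose * E) x) := by
  rw [closedLoop, Matrix.mul_assoc, act_sub, LinearMap.sub_apply, act_mul]

namespace IsAntistrongSolution

theorem transpose_eq (hE : IsAntistrongSolution A B C E) : E.transpose = E := by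
  rw [← Matrix.conjTranspose_eq_transpose_of_trivial]
  exact hE.posSemidef.isHermitian

theorem inner_comm (hE : IsAntistrongSolution A B C E) (x y : Vec n) :
    ⟪act E x, y⟫_ℝ = ⟪x, act E y⟫_ℝ := by
  rw [inner_act_left, hE.transpose_eq]

theorem act_riccati (hE : IsAntistrongSolution A B C E) (x : Vec n) :
    act E (act (closedLoop A B E) x) =
      -act A.transpose (act E x) - act C.transpose (act C x) := by
  have h := congrArg (fun M => act M x) hE.riccati
  simp only [act_add, act_sub, LinearMap.add_apply, LinearMap.sub_apply, act_mul, act_zero,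
    LinearMap.zero_apply] at h
  rw [act_closedLoop, map_sub, act_mul, ← sub_eq_zero, ← h]
  abel

/-- Polarized dissipation identity: along `y' = A₊ y`, the storage `⟪E y, y⟫` decreases at the rate
`‖B* E y‖² + ‖C y‖²`. -/
theorem inner_riccati (hE : IsAntistrongSolution A B C E) (x y : Vec n) :
    ⟪act E x, act (closedLoop A B E) y⟫_ℝ + ⟪act (closedLoop A B E) x, act E y⟫_ℝ +
      ⟪act (B.transpose * E) x, act (B.transpose * E) y⟫_ℝ + ⟪act C x, act C y⟫_ℝ = 0 := by
  rw [hE.inner_comm, hE.act_riccati, act_closedLoop, inner_sub_left, inner_sub_right,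
    inner_neg_right, ← inner_act_left, ← inner_act_left, inner_act_left B, ← act_mul]
  ring

theorem act_eq_zero_of_inner (hE : IsAntistrongSolution A B C E) {x : Vec n}
    (h : ⟪act E x, x⟫_ℝ = 0) : act E x = 0 := by
  have := (hE.posSemidef.dotProduct_mulVec_zero_iff x.ofLp).1 (by
    rw [← h]
    simp [act, Matrix.toLpLin_apply, PiLp.inner_apply, dotProduct, mul_comm])
  simp [act, Matrix.toLpLin_apply, this]

/-- Here `A₊ x = -B B* E x`, so the dissipation identity at `(x, x)` reads `-2‖B* E x‖² + ‖B* E x‖²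
= 0`. -/
theorem feedback_eq_zero (hE : IsAntistrongSolution A B C E) {x : Vec n} (hA : act A x = 0)
    (hC : act C x = 0) : act (B.transpose * E) x = 0 := by
  have h := hE.inner_riccati x x
  rw [act_closedLoop, hA, hC] at h
  simp only [zero_sub, inner_neg_right, inner_neg_left, inner_zero_right] at h
  have h1 : ⟪act E x, act B (act (B.transpose * E) x)⟫_ℝ =
      ⟪act (B.transpose * E) x, act (B.transpose * E) x⟫_ℝ := by
    rw [← inner_act_transpose, ← act_mul]
  have h2 := real_inner_comm (act E x) (act B (act (B.transpose * E) x))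
  rw [← inner_self_eq_zero (𝕜 := ℝ)]
  linarith

/-- On `ker A₊` nothing is dissipated, so feedback and output vanish and `A x = A₊ x = 0`.
Conversely `NO⁰ ⊆ ker A` makes the feedback vanish. -/
theorem closedLoop_eq_zero_iff (hE : IsAntistrongSolution A B C E)
    (hNO : NO0 C A ≤ LinearMap.ker (act A)) (x : Vec n) :
    act (closedLoop A B E) x = 0 ↔ x ∈ NO0 C A := by
  constructor
  · intro h
    have h1 := hE.inner_riccati x x
    rw [h, inner_zero_left, inner_zero_right, real_inner_self_eq_norm_sq,
      real_inner_self_eq_norm_sq] at h1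
    have h2 : ‖act (B.transpose * E) x‖ ^ 2 = 0 := by nlinarith [sq_nonneg ‖act C x‖]
    have h3 : ‖act C x‖ ^ 2 = 0 := by nlinarith
    have h4 : act (B.transpose * E) x = 0 := by simpa using h2
    rw [act_closedLoop, h4, map_zero, sub_zero] at h
    exact mem_NO0_of_act_eq_zero h (by simpa using h3)
  · intro h
    have hA : act A x = 0 := hNO h
    rw [act_closedLoop, hA, hE.feedback_eq_zero hA (act_output_eq_zero_of_mem_NO0 h)]
    simp

/-- Semisimplicity of the eigenvalue `0`. With `v = A₊ x` in the kernel, the identity at `(v, x)`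
gives `⟪E v, v⟫ = 0`, hence `E v = 0`; then the identity at `(x, x)` kills the feedback and the
output of `x`. So `A x = v`, `A² x = 0`, and `x` lies in `NO⁰ ⊆ ker A`. -/
theorem closedLoop_eq_zero_of_sq (hE : IsAntistrongSolution A B C E)
    (hNO : NO0 C A ≤ LinearMap.ker (act A)) {x : Vec n}
    (h : act (closedLoop A B E) (act (closedLoop A B E) x) = 0) :
    act (closedLoop A B E) x = 0 := by
  set v := act (closedLoop A B E) x with hv
  have hvN : v ∈ NO0 C A := (hE.closedLoop_eq_zero_iff hNO v).1 h
  have hAv : act A v = 0 := hNO hvN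
  have hCv : act C v = 0 := act_output_eq_zero_of_mem_NO0 hvN
  have hEv : act E v = 0 := by
    refine hE.act_eq_zero_of_inner ?_
    have h1 := hE.inner_riccati v x
    rwa [h, hE.feedback_eq_zero hAv hCv, hCv, ← hv, inner_zero_left, inner_zero_left,
      inner_zero_left, add_zero, add_zero, add_zero] at h1
  have h1 := hE.inner_riccati x x
  rw [← hv, hE.inner_comm, hEv, ← hE.inner_comm, hEv, inner_zero_left, inner_zero_right,
    real_inner_self_eq_norm_sq, real_inner_self_eq_norm_sq] at h1
  have h2 : ‖act (B.transpose * E) x‖ ^ 2 = 0 := by nlinarith [sq_nonneg ‖act C x‖]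
  have h3 : ‖act C x‖ ^ 2 = 0 := by nlinarith
  have h4 : act (B.transpose * E) x = 0 := by simpa using h2
  have h5 : act A x = v := by rw [hv, act_closedLoop, h4, map_zero, sub_zero]
  have hxN : x ∈ NO0 C A :=
    mem_NO0_of_act_act_eq_zero (by rw [h5, hAv]) (by simpa using h3) (by rw [h5, hCv])
  rw [← h5]
  exact hNO hxN

/-- For an eigenvector `a + i b` the storage terms cancel when the identities at `(a, a)` and `(b,
b)` are added. The feedback and output of `a` and `b` thus vanish, so `A` itself rotates the pair,
which then lies in `NO⁰ ⊆ ker A`. -/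
theorem eigenvalue_eq_zero (hE : IsAntistrongSolution A B C E)
    (hNO : NO0 C A ≤ LinearMap.ker (act A)) {l : ℂ} (hl : l.re = 0)
    (hev : (cact (closedLoop A B E)).HasEigenvalue l) : l = 0 := by
  obtain ⟨y, hy, hy0⟩ := hev.exists_hasEigenvector
  obtain ⟨a, b, rfl⟩ := exists_eq_complexify_add y
  rw [Module.End.mem_eigenspace_iff, cact_complexify_add] at hy
  have hlI : l = (l.im : ℂ) * Complex.I := by
    apply Complex.ext <;> simp [hl]
  obtain ⟨ha, hb⟩ : act (closedLoop A B E) a = -(l.im • b) ∧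
      act (closedLoop A B E) b = l.im • a := by
    refine complexify_add_inj (hy.trans ?_)
    ext i
    rw [hlI]
    simp [complexify]
    linear_combination ((l.im : ℂ) * (b i : ℂ)) * Complex.I_sq
  have h1 := hE.inner_riccati a a
  have h2 := hE.inner_riccati b b
  rw [ha, inner_neg_right, inner_neg_left, inner_smul_left, inner_smul_right,
    real_inner_self_eq_norm_sq, real_inner_self_eq_norm_sq] at h1
  rw [hb, inner_smul_left, inner_smul_right,
    real_inner_self_eq_norm_sq, real_inner_self_eq_norm_sq] at h2
  have h3 : ⟪act E b, a⟫_ℝ = ⟪act E a, b⟫_ℝ := by rw [hE.inner_comm, real_inner_comm]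
  have h4 : ⟪b, act E a⟫_ℝ = ⟪act E a, b⟫_ℝ := real_inner_comm _ _
  have h5 : ⟪a, act E b⟫_ℝ = ⟪act E a, b⟫_ℝ := by rw [hE.inner_comm]
  rw [h4] at h1
  rw [h3, h5] at h2
  simp only [conj_trivial] at h1 h2
  have hs : ‖act (B.transpose * E) a‖ ^ 2 + ‖act C a‖ ^ 2 + ‖act (B.transpose * E) b‖ ^ 2 +
      ‖act C b‖ ^ 2 = 0 := by linarith
  have p1 := sq_nonneg ‖act (B.transpose * E) a‖
  have p2 := sq_nonneg ‖act (B.transpose * E) b‖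
  have p3 := sq_nonneg ‖act C a‖
  have p4 := sq_nonneg ‖act C b‖
  have q1 : act (B.transpose * E) a = 0 := by
    simpa using (show ‖act (B.transpose * E) a‖ ^ 2 = 0 by linarith)
  have q2 : act (B.transpose * E) b = 0 := by
    simpa using (show ‖act (B.transpose * E) b‖ ^ 2 = 0 by linarith)
  have q3 : act C a = 0 := by simpa using (show ‖act C a‖ ^ 2 = 0 by linarith)
  have q4 : act C b = 0 := by simpa using (show ‖act C b‖ ^ 2 = 0 by linarith)
  rw [act_closedLoop, q1, map_zero, sub_zero] at ha
  rw [act_closedLoop, q2, map_zero, sub_zero] at hb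
  have hA : act A a = 0 := hNO (mem_NO0_of_rotation ha hb q3 q4)
  have hB : act A b = 0 := hNO (mem_NO0_of_rotation (a := b) (b := -a) (r := l.im)
    (by simpa using hb) (by rw [map_neg, ha, neg_neg]) q4 (by simpa using q3))
  by_contra hl0
  have him : l.im ≠ 0 := fun h => hl0 (Complex.ext hl h)
  have ha0 : a = 0 := by
    rw [hB] at hb; simpa [him] using hb.symm
  have hb0 : b = 0 := by
    rw [hA] at ha; simpa [him] using ha
  exact hy0 (by simp [ha0, hb0])

/-- Work in `ℂⁿ`, the sum of all generalized eigenspaces: those with `Re l < 0` are invariant, and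
the only other one, at `0`, is annihilated because `0` is semisimple. For the reverse inclusion,
`A₊` is onto on each generalized eigenspace with `l ≠ 0`. -/
theorem range_closedLoop (hE : IsAntistrongSolution A B C E)
    (hNO : NO0 C A ≤ LinearMap.ker (act A)) :
    LinearMap.range (act (closedLoop A B E)) = stableSubspace (closedLoop A B E) := by
  set H := closedLoop A B E with hH
  have hgen : ∀ {l : ℂ} {v : Fin n → ℂ}, v ∈ (cact H).maxGenEigenspace l → v ≠ 0 →
      (cact H).HasEigenvalue l := by
    intro l v hv hv0
    by_contra hev
    rw [Module.End.hasEigenvalue_iff, not_not, Module.End.eigenspace_def,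
      LinearMap.ker_eq_bot] at hev
    obtain ⟨k, hk⟩ := (Module.End.mem_maxGenEigenspace _ _ _).1 hv
    refine hv0 ((hev.iterate k) ?_)
    rw [← Module.End.coe_pow, map_zero]
    exact hk
  apply le_antisymm
  · rintro _ ⟨x, rfl⟩
    show complexify n (act H x) ∈
      (⨆ l ∈ {l : ℂ | l.re < 0}, Module.End.maxGenEigenspace (cact H) l)
    rw [complexify_act]
    have htop : complexify n x ∈ ⨆ l : ℂ, Module.End.maxGenEigenspace (cact H) l := by
      rw [Module.End.iSup_maxGenEigenspace_eq_top]; trivial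
    have hle : (⨆ l : ℂ, Module.End.maxGenEigenspace (cact H) l) ≤
        (⨆ l ∈ {l : ℂ | l.re < 0}, Module.End.maxGenEigenspace (cact H) l).comap (cact H) := by
      refine iSup_le fun l v hv => ?_
      rw [Submodule.mem_comap]
      rcases eq_or_ne v 0 with rfl | hv0
      · rw [map_zero]; exact Submodule.zero_mem _
      have hev := hgen hv hv0
      have hre : l.re ≤ 0 := by
        refine hE.re_nonpos l ?_
        rw [← Matrix.spectrum_toLin']
        exact Module.End.hasEigenvalue_iff_mem_spectrum.1 hev
      rcases hre.lt_or_eq with hlt | heq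
      · refine Submodule.mem_iSup_of_mem l (Submodule.mem_iSup_of_mem hlt ?_)
        exact Module.End.mapsTo_maxGenEigenspace_of_comm (Commute.refl _) l hv
      · have hl0 := hE.eigenvalue_eq_zero hNO heq hev
        subst hl0
        obtain ⟨k, hk⟩ := (Module.End.mem_maxGenEigenspace _ _ _).1 hv
        rw [zero_smul, sub_zero] at hk
        have hsq : ∀ w : Fin n → ℂ, cact H (cact H w) = 0 → cact H w = 0 := by
          intro w hw
          obtain ⟨a, b, rfl⟩ := exists_eq_complexify_add w
          rw [cact_complexify_add, cact_complexify_add] at hw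
          obtain ⟨ha, hb⟩ := complexify_add_inj (a' := 0) (b' := 0) (by simpa using hw)
          rw [cact_complexify_add, hE.closedLoop_eq_zero_of_sq hNO ha,
            hE.closedLoop_eq_zero_of_sq hNO hb]
          simp
        have hpow : ∀ k : ℕ, ((cact H) ^ k) v = 0 → cact H v = 0 := by
          intro k
          induction k with
          | zero => intro h; exact (hv0 h).elim
          | succ k ih =>
            intro h
            rcases k with _ | k
            · simpa using h
            · refine ih ?_
              rw [pow_succ', pow_succ'] at h
              rw [pow_succ']
              exact hsq _ h
        rw [hpow k hk]
        exact Submodule.zero_mem _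
    exact hle htop
  · intro x hx
    have hle : (⨆ l ∈ {l : ℂ | l.re < 0}, Module.End.maxGenEigenspace (cact H) l) ≤
        LinearMap.range (cact H) := by
      refine iSup₂_le fun l hl v hv => ?_
      obtain ⟨k, hk⟩ := (Module.End.mem_maxGenEigenspace _ _ _).1 hv
      have hl0 : l ≠ 0 := by rintro rfl; simp at hl
      clear hv
      induction k generalizing v with
      | zero =>
        have : v = 0 := hk
        rw [this]; exact Submodule.zero_mem _
      | succ k ih =>
        have h1 := ih ((cact H - l • 1) v) (by rw [pow_succ] at hk; exact hk)
        -- Write `v` through `A₊ v` and `(A₊ - l) v`; the latter has smaller height and is in the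
        -- range by induction.
        have h2 : v = l⁻¹ • (cact H v - (cact H - l • 1) v) := by
          simp [hl0]
        rw [h2]
        exact Submodule.smul_mem _ _ (Submodule.sub_mem _ ⟨v, rfl⟩ h1)
    obtain ⟨y, hy⟩ := hle hx
    obtain ⟨a, b, rfl⟩ := exists_eq_complexify_add y
    rw [cact_complexify_add] at hy
    exact ⟨a, (complexify_add_inj (b' := 0) (by simpa using hy)).1⟩

theorem isCompl_NO0_stableSubspace (hE : IsAntistrongSolution A B C E)
    (hNO : NO0 C A ≤ LinearMap.ker (act A)) :
    IsCompl (NO0 C A) (stableSubspace (closedLoop A B E)) := by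
  have hker : NO0 C A = LinearMap.ker (act (closedLoop A B E)) := by
    ext x
    rw [LinearMap.mem_ker, hE.closedLoop_eq_zero_iff hNO]
  rw [← hE.range_closedLoop hNO, hker]
  refine (Submodule.isCompl_iff_disjoint _ _ ?_).2 ?_
  · rw [add_comm, LinearMap.finrank_range_add_finrank_ker]
  rw [Submodule.disjoint_def]
  rintro _ h ⟨x, rfl⟩
  exact hE.closedLoop_eq_zero_of_sq hNO h

end IsAntistrongSolution
end Algebra

/-! ### Exponential dichotomy, Gramian and turnpike estimates for the closed loop. -/

section Dichotomy

variable {n m : ℕ}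

/-- `P + Q = 1` splits the space into the kernel of `M` and an invariant subspace on which
`exp (t M)` decays exponentially. -/
structure ExpDichotomy (M P Q : Vec n →L[ℝ] Vec n) (k μ : ℝ) : Prop where
  add_eq_one : P + Q = 1
  mul_left : M * P = 0
  mul_right : P * M = 0
  proj_mul : P * Q = 0
  k_pos : 0 < k
  μ_pos : 0 < μ
  decay : ∀ t : ℝ, 0 ≤ t → ‖flow M t * Q‖ ≤ k * Real.exp (-μ * t)

/-- The Gramian `∫₀ᵀ exp (s M) B B* exp (s M*) ds`. -/
noncomputable def gramian (M : Vec n →L[ℝ] Vec n) (B : Vec m →L[ℝ] Vec n) (T : ℝ) :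
    Vec n →L[ℝ] Vec n :=
  ∫ s in (0 : ℝ)..T, (flow M s ∘L B) ∘L (flow M s ∘L B).adjoint

/-- Observability of the adjoint system on `[0, 1]`. -/
def IsAdjointObservable (M : Vec n →L[ℝ] Vec n) (B : Vec m →L[ℝ] Vec n) : Prop :=
  ∀ q : Vec n, (∀ s ∈ Icc (0 : ℝ) 1, (flow M s ∘L B).adjoint q = 0) → q = 0

theorem continuous_adjoint_flow_comp (M : Vec n →L[ℝ] Vec n) (B : Vec m →L[ℝ] Vec n) :
    Continuous fun s => (flow M s ∘L B).adjoint :=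
  ContinuousLinearMap.adjoint.continuous.comp ((continuous_flow M).clm_comp continuous_const)

theorem gramian_apply (M : Vec n →L[ℝ] Vec n) (B : Vec m →L[ℝ] Vec n) (T : ℝ) (q : Vec n) :
    gramian M B T q = ∫ s in (0 : ℝ)..T, flow M s (B ((flow M s ∘L B).adjoint q)) := by
  rw [gramian, ContinuousLinearMap.intervalIntegral_apply]
  · rfl
  · exact (((continuous_flow M).clm_comp continuous_const).clm_comp
      (continuous_adjoint_flow_comp M B)).intervalIntegrable _ _

theorem inner_gramian (M : Vec n →L[ℝ] Vec n) (B : Vec m →L[ℝ] Vec n) (T : ℝ) (q : Vec n) :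
    ⟪q, gramian M B T q⟫_ℝ = ∫ s in (0 : ℝ)..T, ‖(flow M s ∘L B).adjoint q‖ ^ 2 := by
  have hc := continuous_adjoint_flow_comp M B
  have hi : IntervalIntegrable (fun s => flow M s (B ((flow M s ∘L B).adjoint q))) volume 0 T :=
    ((continuous_flow M).clm_apply (B.continuous.comp
      (hc.clm_apply continuous_const))).intervalIntegrable _ _
  have h := (innerSL ℝ q).intervalIntegral_comp_comm hi
  rw [gramian_apply]
  refine Eq.trans h.symm (intervalIntegral.integral_congr fun s _ => ?_)
  simp only [innerSL_apply_apply]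
  rw [← real_inner_self_eq_norm_sq, ContinuousLinearMap.adjoint_inner_left]
  rfl

/-- The Gramian increases with `T`, so the minimum of its quadratic form over the compact unit
sphere at `T = 1` serves all `T ≥ 1`. -/
theorem exists_gramian_coercive {M : Vec n →L[ℝ] Vec n} {B : Vec m →L[ℝ] Vec n}
    (h : IsAdjointObservable M B) :
    ∃ c : ℝ, 0 < c ∧ ∀ T : ℝ, 1 ≤ T → ∀ q : Vec n, c * ‖q‖ ^ 2 ≤ ⟪q, gramian M B T q⟫_ℝ := by
  have hc := continuous_adjoint_flow_comp M B
  have hcq : ∀ q, Continuous fun s => ‖(flow M s ∘L B).adjoint q‖ ^ 2 := fun q =>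
    ((hc.clm_apply continuous_const).norm).pow 2
  have hmono : ∀ T : ℝ, 1 ≤ T → ∀ q : Vec n,
      ⟪q, gramian M B 1 q⟫_ℝ ≤ ⟪q, gramian M B T q⟫_ℝ := by
    intro T hT q
    rw [inner_gramian, inner_gramian]
    exact intervalIntegral.integral_mono_interval le_rfl zero_le_one hT
      (Filter.Eventually.of_forall fun s => by positivity) ((hcq q).intervalIntegrable _ _)
  have hpos : ∀ q : Vec n, q ≠ 0 → 0 < ⟪q, gramian M B 1 q⟫_ℝ := by
    intro q hq
    rw [inner_gramian]
    refine intervalIntegral.integral_pos zero_lt_one (hcq q).continuousOn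
      (fun s _ => by positivity) ?_
    by_contra! hcon
    refine hq (h q fun s hs => ?_)
    have h1 := hcon s hs
    have h2 := sq_nonneg ‖(flow M s ∘L B).adjoint q‖
    simpa using le_antisymm h1 h2
  have hcont : Continuous fun q : Vec n => ⟪q, gramian M B 1 q⟫_ℝ :=
    continuous_id.inner (gramian M B 1).continuous
  by_cases hne : (Metric.sphere (0 : Vec n) 1).Nonempty
  · obtain ⟨q₀, hq₀, hmin⟩ := (isCompact_sphere (0 : Vec n) 1).exists_isMinOn hne
      hcont.continuousOn
    have hq₀1 : ‖q₀‖ = 1 := by simpa using hq₀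
    have hq₀0 : q₀ ≠ 0 := by rintro rfl; simp at hq₀1
    refine ⟨_, hpos q₀ hq₀0, fun T hT q => le_trans ?_ (hmono T hT q)⟩
    rcases eq_or_ne q 0 with rfl | hq
    · simp
    have h1 := hmin (show ‖q‖⁻¹ • q ∈ Metric.sphere (0 : Vec n) 1 by
      simp [norm_smul, hq])
    simp only [mem_ofPred_eq, map_smul, inner_smul_left, inner_smul_right, conj_trivial] at h1
    have h2 : 0 < ‖q‖ := norm_pos_iff.2 hq
    calc _ ≤ (‖q‖⁻¹ * (‖q‖⁻¹ * ⟪q, gramian M B 1 q⟫_ℝ)) * ‖q‖ ^ 2 := by gcongr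
      _ = _ := by field_simp
  · refine ⟨1, one_pos, fun T hT q => le_trans ?_ (hmono T hT q)⟩
    have hq : q = 0 := by
      by_contra hq
      exact hne ⟨‖q‖⁻¹ • q, by simp [norm_smul, hq]⟩
    simp [hq]

/-- Two-point boundary value problem for the closed loop system driven by the adjoint flow. -/
theorem exists_boundary_value_solution {M : Vec n →L[ℝ] Vec n} {B : Vec m →L[ℝ] Vec n} {c T : ℝ}
    (hc : 0 < c) (hG : ∀ q : Vec n, c * ‖q‖ ^ 2 ≤ ⟪q, gramian M B T q⟫_ℝ) (y₀ y₁ : Vec n) :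
    ∃ (q : Vec n) (y : ℝ → Vec n),
      (∀ t, HasDerivAt y (M (y t) - B (B.adjoint ((flow M (T - t)).adjoint q))) t) ∧
      y 0 = y₀ ∧ y T = y₁ ∧ c * ‖q‖ ≤ ‖flow M T y₀ - y₁‖ := by
  have hinj : Function.Injective (gramian M B T : Vec n →ₗ[ℝ] Vec n) := by
    rw [← LinearMap.ker_eq_bot, LinearMap.ker_eq_bot']
    intro q hq
    have h1 := hG q
    rw [show gramian M B T q = 0 from hq, inner_zero_right] at h1
    have h2 : ‖q‖ ^ 2 ≤ 0 := by
      by_contra! h3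
      nlinarith
    simpa using le_antisymm h2 (sq_nonneg _)
  -- The terminal condition is `gramian q = exp(T M) y₀ - y₁`; coercivity gives solvability and, by
  -- Cauchy–Schwarz, the bound on `q`.
  obtain ⟨q, hq⟩ := LinearMap.injective_iff_surjective.1 hinj (flow M T y₀ - y₁)
  replace hq : gramian M B T q = flow M T y₀ - y₁ := hq
  let F : ℝ → Vec n := fun s => B ((flow M s ∘L B).adjoint q)
  have hF : Continuous F :=
    B.continuous.comp ((continuous_adjoint_flow_comp M B).clm_apply continuous_const)
  have hFs : ∀ s, F s = B (B.adjoint ((flow M s).adjoint q)) := fun s => by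
    simp [F, ContinuousLinearMap.adjoint_comp]
  have hinv : ∀ t x, flow M t (flow M (-t) x) = x := fun t x => by
    have := flow_add M t (-t)
    rw [add_neg_cancel, flow_zero] at this
    exact (congrArg (fun L => L x) this).symm
  let g : ℝ → Vec n := fun s => flow M (-s) (F (T - s))
  have hg : Continuous g := ((continuous_flow M).comp continuous_neg).clm_apply
    (hF.comp (continuous_const.sub continuous_id))
  refine ⟨q, fun t => flow M t (y₀ - ∫ s in (0 : ℝ)..t, g s), fun t => ?_, by simp, ?_, ?_⟩
  · have h1 : HasDerivAt (fun t => y₀ - ∫ s in (0 : ℝ)..t, g s) (-g t) t :=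
      (intervalIntegral.integral_hasDerivAt_right (hg.intervalIntegrable _ _)
        (hg.stronglyMeasurableAtFilter volume _) hg.continuousAt).const_sub y₀
    refine ((hasDerivAt_flow M t).clm_apply h1).congr_deriv ?_
    rw [map_neg, hinv, ← sub_eq_add_neg, hFs]
    rfl
  · have h1 := (flow M T).intervalIntegral_comp_comm (μ := volume) (hg.intervalIntegrable 0 T)
    have h2 : ∀ s, flow M T (g s) = flow M (T - s) (F (T - s)) := fun s => by
      rw [sub_eq_add_neg T s, flow_add]
      rfl
    have h3 : ∫ s in (0 : ℝ)..T, flow M (T - s) (F (T - s)) = gramian M B T q := by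
      rw [intervalIntegral.integral_comp_sub_left (fun s => flow M s (F s)), gramian_apply]
      simp [F]
    simp only [h2] at h1
    show flow M T (y₀ - ∫ s in (0 : ℝ)..T, g s) = y₁
    rw [map_sub, ← h1, h3, hq]
    abel
  · rw [← hq]
    rcases eq_or_ne q 0 with rfl | hq0
    · simp
    have h1 := (hG q).trans (real_inner_le_norm _ _)
    have h2 : 0 < ‖q‖ := norm_pos_iff.2 hq0
    nlinarith

namespace ExpDichotomy

variable {M P Q : Vec n →L[ℝ] Vec n} {k μ : ℝ}

theorem flow_mul_proj (h : ExpDichotomy M P Q k μ) (t : ℝ) : flow M t * P = P :=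
  flow_comp_of_comp_eq_zero h.mul_left t

theorem flow_eq (h : ExpDichotomy M P Q k μ) (t : ℝ) : flow M t = P + flow M t * Q := by
  rw [← h.flow_mul_proj t, ← mul_add, h.add_eq_one, mul_one]

theorem norm_flow_le (h : ExpDichotomy M P Q k μ) {t : ℝ} (ht : 0 ≤ t) :
    ‖flow M t‖ ≤ ‖P‖ + k := by
  rw [h.flow_eq t]
  refine (norm_add_le _ _).trans (add_le_add le_rfl ((h.decay t ht).trans ?_))
  have : Real.exp (-μ * t) ≤ 1 := Real.exp_le_one_iff.2 (by nlinarith [h.μ_pos])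
  nlinarith [h.k_pos]

/-- Source of the turnpike: the backward adjoint flow forgets everything but `P* q`. -/
theorem norm_adjoint_flow_sub_le (h : ExpDichotomy M P Q k μ) {t : ℝ} (ht : 0 ≤ t) (q : Vec n) :
    ‖(flow M t).adjoint q - P.adjoint q‖ ≤ k * Real.exp (-μ * t) * ‖q‖ := by
  have h1 : (flow M t).adjoint q - P.adjoint q = (flow M t * Q).adjoint q := by
    conv_lhs => rw [h.flow_eq t]
    rw [map_add]
    simp
  rw [h1]
  refine (ContinuousLinearMap.le_opNorm _ _).trans ?_
  rw [LinearIsometryEquiv.norm_map]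
  gcongr
  exact h.decay t ht

theorem mul_proj_eq (h : ExpDichotomy M P Q k μ) : Q * M = M * Q := by
  have h1 : Q = 1 - P := eq_sub_of_add_eq' h.add_eq_one
  rw [h1, sub_mul, mul_sub, h.mul_left, h.mul_right, one_mul, mul_one]

/-- A right inverse of `M` on the stable part. -/
theorem exists_inverse (h : ExpDichotomy M P Q k μ) (hker : ∀ x, M x = 0 → Q x = 0) :
    ∃ R : Vec n →L[ℝ] Vec n, M * R = Q ∧ P * R = 0 := by
  have hQP : Q * P = 0 := by
    ext1 x
    exact hker (P x) (congrArg (fun L => L x) h.mul_left)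
  have hPP : P * P = P := by
    conv_rhs => rw [← one_mul P, ← h.add_eq_one, add_mul, hQP, add_zero]
  -- `M + P` is invertible: `P` replaces the zero block of `M` on its kernel. Then `R` is `(M + P)⁻¹
  -- Q`.
  have hinj : Function.Injective ((M + P : Vec n →L[ℝ] Vec n) : Vec n →ₗ[ℝ] Vec n) := by
    rw [← LinearMap.ker_eq_bot, LinearMap.ker_eq_bot']
    intro x hx
    replace hx : M x + P x = 0 := hx
    have h1 : P x = 0 := by
      have := congrArg P hx
      rw [map_add, map_zero, show P (M x) = 0 from congrArg (fun L => L x) h.mul_right, zero_add,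
        show P (P x) = P x from congrArg (fun L => L x) hPP] at this
      exact this
    rw [h1, add_zero] at hx
    have h2 : P x + Q x = x := congrArg (fun L => L x) h.add_eq_one
    rw [← h2, h1, hker x hx, add_zero]
  obtain ⟨g, hg⟩ := LinearMap.exists_rightInverse_of_surjective _
    (LinearMap.range_eq_top.2 (LinearMap.injective_iff_surjective.1 hinj))
  have hg' : ∀ x, M (g x) + P (g x) = x := fun x => congrArg (fun L => L x) hg
  have hPM : ∀ x, P (M x) = 0 := fun x => congrArg (fun L => L x) h.mul_right
  have hPP' : ∀ x, P (P x) = P x := fun x => congrArg (fun L => L x) hPP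
  have hPQ : ∀ x, P (Q x) = 0 := fun x => congrArg (fun L => L x) h.proj_mul
  have hPg : ∀ x, P (g (Q x)) = 0 := fun x => by
    have := congrArg P (hg' (Q x))
    rwa [map_add, hPM, zero_add, hPP', hPQ] at this
  refine ⟨LinearMap.toContinuousLinearMap g * Q, ?_, ?_⟩
  · ext1 x
    have := hg' (Q x)
    rw [hPg, add_zero] at this
    exact this
  · ext1 x
    exact hPg x

/-- `R (G qh)` is the equilibrium of the stable part under the constant forcing `-G qh`. The
deviation `e` from it solves `e' = M e - Q G r`, with `r` concentrated near `T`. -/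
theorem norm_stable_part_le (h : ExpDichotomy M P Q k μ) {R G : Vec n →L[ℝ] Vec n}
    (hMR : M * R = Q) (hPR : P * R = 0) {T t : ℝ} (ht : t ∈ Icc 0 T) {b : ℝ} (hb : 0 ≤ b)
    {qh : Vec n} {r y : ℝ → Vec n} (hr : ∀ s ∈ Ico 0 t, ‖r s‖ ≤ k * Real.exp (-μ * (T - s)) * b)
    (hy : ∀ t, HasDerivAt y (M (y t) - G (qh + r t)) t) :
    ‖Q (y t) - R (G qh)‖ ≤ k * Real.exp (-μ * t) * ‖Q (y 0) - R (G qh)‖ +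
      k ^ 2 * ‖G‖ / (2 * μ) * b * Real.exp (-μ * (T - t)) := by
  have hk := h.k_pos
  have hμ := h.μ_pos
  have hPQ : ∀ x, P (Q x) = 0 := fun x => congrArg (fun L => L x) h.proj_mul
  have hPR' : ∀ x, P (R x) = 0 := fun x => congrArg (fun L => L x) hPR
  have hadd : ∀ x, P x + Q x = x := fun x => congrArg (fun L => L x) h.add_eq_one
  have hQM : ∀ x, Q (M x) = M (Q x) := fun x => congrArg (fun L => L x) h.mul_proj_eq
  have hMR' : ∀ x, M (R x) = Q x := fun x => congrArg (fun L => L x) hMR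
  have he' : ∀ s, HasDerivAt (fun s => Q (y s) - R (G qh))
      (M (Q (y s) - R (G qh)) + -(Q (G (r s)))) s := fun s => by
    refine ((Q.hasFDerivAt.comp_hasDerivAt s (hy s)).sub_const _).congr_deriv ?_
    simp only [map_sub, map_add, hQM, hMR']
    abel
  have hh : ∀ s, HasDerivAt (fun s => flow M (t - s) (Q (y s) - R (G qh)))
      (flow M (t - s) (-(Q (G (r s))))) s := fun s =>
    hasDerivAt_flow_sub_apply M t (y := fun s => Q (y s) - R (G qh))
      (f := fun s => -(Q (G (r s)))) (he' s)
  have hQe : ∀ s, Q (Q (y s) - R (G qh)) = Q (y s) - R (G qh) := fun s => by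
    have h1 := hadd (Q (y s) - R (G qh))
    rwa [map_sub P, hPQ, hPR', sub_zero, zero_add] at h1
  have hflow : ∀ s x, 0 ≤ s → ‖flow M s (Q x)‖ ≤ k * Real.exp (-μ * s) * ‖x‖ := fun s x hs =>
    (ContinuousLinearMap.le_opNorm (flow M s * Q) x).trans
      (mul_le_mul_of_nonneg_right (h.decay s hs) (norm_nonneg x))
  -- The rate `2 μ` arises from `exp(-μ (t - s)) exp(-μ (T - s)) = exp(-μ (t + T)) exp(2 μ s)`.
  have hbd := norm_le_add_exp_of_norm_deriv_le ht.1 (a := 2 * μ)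
    (c := k ^ 2 * ‖G‖ * b * Real.exp (-μ * (t + T))) (by positivity) hh (by positivity) ?_
  · simp only [sub_self, flow_zero, sub_zero] at hbd
    have h0 := hflow t (Q (y 0) - R (G qh)) ht.1
    rw [hQe 0] at h0
    refine hbd.trans (add_le_add h0 (le_of_eq ?_))
    rw [show -μ * (T - t) = -μ * (t + T) + 2 * μ * t by ring, Real.exp_add]
    ring
  · intro s hs
    rw [map_neg, norm_neg]
    calc ‖flow M (t - s) (Q (G (r s)))‖ ≤ k * Real.exp (-μ * (t - s)) * ‖G (r s)‖ :=
          hflow _ _ (by linarith [hs.2])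
      _ ≤ (k * Real.exp (-μ * (t - s))) * (‖G‖ * (k * Real.exp (-μ * (T - s)) * b)) := by
          gcongr
          exact (ContinuousLinearMap.le_opNorm _ _).trans (by gcongr; exact hr s hs)
      _ = k ^ 2 * ‖G‖ * b * (Real.exp (-μ * (t - s)) * Real.exp (-μ * (T - s))) := by ring
      _ = k ^ 2 * ‖G‖ * b * (Real.exp (-μ * (t + T)) * Real.exp (2 * μ * s)) := by
          rw [← Real.exp_add, ← Real.exp_add]; congr 2; ring
      _ = _ := by ring

/-- As `P M = 0`, the component `P y` just integrates the forcing: a linear drift plus an integrable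
tail. -/
theorem norm_kernel_part_le (h : ExpDichotomy M P Q k μ) {G : Vec n →L[ℝ] Vec n}
    {T t : ℝ} (ht : t ∈ Icc 0 T) {b : ℝ} (hb : 0 ≤ b)
    {qh : Vec n} {r y : ℝ → Vec n} (hr : ∀ s ∈ Ico 0 t, ‖r s‖ ≤ k * Real.exp (-μ * (T - s)) * b)
    (hy : ∀ t, HasDerivAt y (M (y t) - G (qh + r t)) t) :
    ‖P (y t - (y 0 - t • G qh))‖ ≤ ‖P‖ * ‖G‖ * k / μ * b * Real.exp (-μ * (T - t)) := by
  have hk := h.k_pos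
  have hμ := h.μ_pos
  have hPM : ∀ x, P (M x) = 0 := fun x => congrArg (fun L => L x) h.mul_right
  have hd : ∀ s, HasDerivAt (fun s => P (y s - (y 0 - s • G qh))) (-(P (G (r s)))) s := by
    intro s
    have h1 : HasDerivAt (fun s : ℝ => y 0 - s • G qh) (-G qh) s := by
      simpa using ((hasDerivAt_id s).smul_const (G qh)).const_sub (y 0)
    refine (P.hasFDerivAt.comp_hasDerivAt s ((hy s).sub h1)).congr_deriv ?_
    simp only [map_sub, map_add, map_neg, hPM]
    abel
  have hbd := norm_le_add_exp_of_norm_deriv_le ht.1 hμ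
    (c := ‖P‖ * ‖G‖ * k * b * Real.exp (-μ * T)) hd (by positivity) ?_
  · simp only [zero_smul, sub_zero, sub_self, map_zero, norm_zero, zero_add] at hbd
    refine hbd.trans (le_of_eq ?_)
    rw [show -μ * (T - t) = -μ * T + μ * t by ring, Real.exp_add]
    ring
  · intro s hs
    rw [norm_neg]
    calc ‖P (G (r s))‖ ≤ ‖P‖ * (‖G‖ * (k * Real.exp (-μ * (T - s)) * b)) := by
          refine (ContinuousLinearMap.le_opNorm _ _).trans ?_
          gcongr
          exact (ContinuousLinearMap.le_opNorm _ _).trans (by gcongr; exact hr s hs)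
      _ = ‖P‖ * ‖G‖ * k * b * Real.exp (-μ * T) * Real.exp (μ * s) := by
          rw [show -μ * (T - s) = -μ * T + μ * s by ring, Real.exp_add]; ring

/-- Exponential turnpike estimates for the closed loop system driven by the adjoint flow. -/
theorem exists_turnpike_bound (h : ExpDichotomy M P Q k μ) {R : Vec n →L[ℝ] Vec n}
    (hMR : M * R = Q) (hPR : P * R = 0) (B : Vec m →L[ℝ] Vec n) :
    ∃ L : ℝ, 0 < L ∧ ∀ (T : ℝ) (q : Vec n) (y : ℝ → Vec n),
      (∀ t, HasDerivAt y (M (y t) - B (B.adjoint ((flow M (T - t)).adjoint q))) t) →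
      ∀ t ∈ Icc 0 T,
        ‖Q (y t) - R (B (B.adjoint (P.adjoint q)))‖ ≤
          L * (‖y 0‖ + ‖q‖) * (Real.exp (-μ * t) + Real.exp (-μ * (T - t))) ∧
        ‖P (y t - (y 0 - t • B (B.adjoint (P.adjoint q))))‖ ≤
          L * ‖q‖ * Real.exp (-μ * (T - t)) := by
  have hk := h.k_pos
  have hμ := h.μ_pos
  obtain ⟨G, hG⟩ : ∃ G : Vec n →L[ℝ] Vec n, ∀ x, B (B.adjoint x) = G x :=
    ⟨B ∘L B.adjoint, fun _ => rfl⟩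
  simp only [hG]
  have p1 : 0 ≤ k ^ 2 * ‖G‖ / (2 * μ) := by positivity
  have p2 : 0 ≤ ‖P‖ * ‖G‖ * k / μ := by positivity
  have p3 : 0 ≤ k * ‖Q‖ := by positivity
  have p4 : 0 ≤ k * (‖R‖ * ‖G‖ * ‖P‖) := by positivity
  refine ⟨k * ‖Q‖ + k * (‖R‖ * ‖G‖ * ‖P‖) + k ^ 2 * ‖G‖ / (2 * μ) + ‖P‖ * ‖G‖ * k / μ + 1,
    by positivity, fun T q y hy t ht => ?_⟩
  have hr : ∀ s ∈ Ico 0 t, ‖(flow M (T - s)).adjoint q - P.adjoint q‖ ≤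
      k * Real.exp (-μ * (T - s)) * ‖q‖ := fun s hs =>
    h.norm_adjoint_flow_sub_le (by linarith [hs.2, ht.2]) q
  have hyr : ∀ t, HasDerivAt y
      (M (y t) - G (P.adjoint q + ((flow M (T - t)).adjoint q - P.adjoint q))) t := fun t => by
    rw [add_sub_cancel]; exact hy t
  have he1 := Real.exp_pos (-μ * t)
  have he2 := Real.exp_pos (-μ * (T - t))
  have b1 := h.norm_stable_part_le hMR hPR ht (norm_nonneg q) hr hyr
  have b2 := h.norm_kernel_part_le ht (norm_nonneg q) hr hyr
  generalize Real.exp (-μ * t) = e1 at *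
  generalize Real.exp (-μ * (T - t)) = e2 at *
  have h0 : ‖Q (y 0) - R (G (P.adjoint q))‖ ≤ ‖Q‖ * ‖y 0‖ + ‖R‖ * ‖G‖ * ‖P‖ * ‖q‖ := by
    refine (norm_sub_le _ _).trans (add_le_add (ContinuousLinearMap.le_opNorm _ _) ?_)
    rw [mul_assoc, mul_assoc]
    refine (ContinuousLinearMap.le_opNorm _ _).trans ?_
    gcongr
    refine (ContinuousLinearMap.le_opNorm _ _).trans ?_
    gcongr
    refine (ContinuousLinearMap.le_opNorm _ _).trans ?_
    rw [LinearIsometryEquiv.norm_map]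
  have hy0 := norm_nonneg (y 0)
  have hq0 := norm_nonneg q
  generalize ‖y 0‖ = a at *
  generalize ‖q‖ = b at *
  constructor
  · calc _ ≤ k * e1 * (‖Q‖ * a + ‖R‖ * ‖G‖ * ‖P‖ * b) + k ^ 2 * ‖G‖ / (2 * μ) * b * e2 := by
          refine b1.trans ?_
          gcongr
      _ ≤ (k * ‖Q‖ + k * (‖R‖ * ‖G‖ * ‖P‖)) * (a + b) * e1 +
            k ^ 2 * ‖G‖ / (2 * μ) * (a + b) * e2 := by
          have : 0 ≤ k * ‖Q‖ * b * e1 + k * (‖R‖ * ‖G‖ * ‖P‖) * a * e1 := by positivity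
          have : 0 ≤ k ^ 2 * ‖G‖ / (2 * μ) * a * e2 := by positivity
          linarith
      _ ≤ _ := by
          rw [mul_add _ e1 e2]
          exact add_le_add
            (mul_le_mul_of_nonneg_right (mul_le_mul_of_nonneg_right (by linarith) (by positivity))
              he1.le)
            (mul_le_mul_of_nonneg_right (mul_le_mul_of_nonneg_right (by linarith) (by positivity))
              he2.le)
  · refine b2.trans ?_
    gcongr
    linarith

end ExpDichotomy
end Dichotomy

/-! ### Carathéodory trajectories, sufficiency of the Hamiltonian system, observability. -/

section Trajectories

variable {n m : ℕ} {A : Matrix (Fin n) (Fin n) ℝ} {B : Matrix (Fin n) (Fin m) ℝ}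
  {C E : Matrix (Fin n) (Fin n) ℝ} {T : ℝ} {x₀ x₁ z : Vec n} {u : ℝ → Vec m} {x : ℝ → Vec n}

theorem adjoint_actL {k l : ℕ} (M : Matrix (Fin k) (Fin l) ℝ) :
    (actL M).adjoint = actL M.transpose := by
  refine ((ContinuousLinearMap.eq_adjoint_iff _ _).2 fun x y => ?_).symm
  exact inner_act_transpose M x y

namespace IsTrajectory

theorem memLp_Ioc (h : IsTrajectory A B T x₀ x₁ u x) :
    MemLp u 2 (volume.restrict (Ioc 0 T)) :=
  h.memLp.mono_measure (Measure.restrict_mono Ioc_subset_Icc_self le_rfl)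

theorem continuousOn_uIcc (h : IsTrajectory A B T x₀ x₁ u x) (hT : 0 ≤ T) :
    ContinuousOn x (uIcc 0 T) := by
  rw [uIcc_of_le hT]; exact h.continuousOn

theorem intervalIntegrable_control (h : IsTrajectory A B T x₀ x₁ u x) (hT : 0 ≤ T) :
    IntervalIntegrable u volume 0 T :=
  (intervalIntegrable_iff_integrableOn_Ioc_of_le hT).2 (h.memLp_Ioc.integrable one_le_two)

theorem intervalIntegrable_rhs (h : IsTrajectory A B T x₀ x₁ u x) (hT : 0 ≤ T) :
    IntervalIntegrable (fun s => act A (x s) + act B (u s)) volume 0 T := by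
  have hu := h.intervalIntegrable_control hT
  exact (((actL A).continuous.comp_continuousOn (h.continuousOn_uIcc hT)).intervalIntegrable).add
    ⟨(actL B).integrable_comp hu.1, (actL B).integrable_comp hu.2⟩

theorem initial (h : IsTrajectory A B T x₀ x₁ u x) (hT : 0 ≤ T) : x 0 = x₀ := by
  simpa using h.state_eq 0 ⟨le_rfl, hT⟩

theorem intervalIntegrable_cost (h : IsTrajectory A B T x₀ x₁ u x) (hT : 0 ≤ T)
    (C : Matrix (Fin n) (Fin n) ℝ) (z : Vec n) :
    IntervalIntegrable (fun t => ‖u t‖ ^ 2 + ‖act C (x t) - z‖ ^ 2) volume 0 T := by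
  refine IntervalIntegrable.add ?_ ?_
  · exact (intervalIntegrable_iff_integrableOn_Ioc_of_le hT).2
      (h.memLp_Ioc.integrable_norm_pow (by norm_num))
  · exact (((((actL C).continuous.comp_continuousOn (h.continuousOn_uIcc hT)).sub
      continuousOn_const).norm).pow 2).intervalIntegrable

theorem sub {x₀' x₁' : Vec n} {u' : ℝ → Vec m} {x' : ℝ → Vec n}
    (h : IsTrajectory A B T x₀ x₁ u x) (h' : IsTrajectory A B T x₀' x₁' u' x') (hT : 0 ≤ T) :
    IsTrajectory A B T (x₀ - x₀') (x₁ - x₁') (fun t => u t - u' t) (fun t => x t - x' t) where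
  memLp := h.memLp.sub h'.memLp
  continuousOn := h.continuousOn.sub h'.continuousOn
  state_eq t ht := by
    have hsub : uIcc 0 t ⊆ uIcc 0 T := by
      rw [uIcc_of_le ht.1, uIcc_of_le hT]; exact Icc_subset_Icc_right ht.2
    rw [h.state_eq t ht, h'.state_eq t ht, add_sub_add_comm, ← intervalIntegral.integral_sub
      ((h.intervalIntegrable_rhs hT).mono_set hsub) ((h'.intervalIntegrable_rhs hT).mono_set hsub)]
    congr 1
    refine intervalIntegral.integral_congr fun s _ => ?_
    simp only [map_sub]
    abel
  endpoint := by rw [h.endpoint, h'.endpoint]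

/-- Green's formula for a trajectory paired with a `C¹` costate. -/
theorem integral_costate (h : IsTrajectory A B T x₀ x₁ u x) (hT : 0 ≤ T) {t : ℝ}
    (ht : t ∈ Icc 0 T) {p p' : ℝ → Vec n} (hp : ∀ t, HasDerivAt p (p' t) t) (hp' : Continuous p') :
    ∫ s in (0 : ℝ)..t, (⟪p' s, x s⟫_ℝ + ⟪p s, act A (x s) + act B (u s)⟫_ℝ) =
      ⟪p t, x t⟫_ℝ - ⟪p 0, x₀⟫_ℝ := by
  have hsub : uIcc 0 t ⊆ uIcc 0 T := by
    rw [uIcc_of_le ht.1, uIcc_of_le hT]; exact Icc_subset_Icc_right ht.2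
  rw [integral_inner_deriv_add_inner ht.1 hp hp' ((h.intervalIntegrable_rhs hT).mono_set hsub)
    fun s hs => h.state_eq s ⟨hs.1, hs.2.trans ht.2⟩, h.initial hT]

/-- A trajectory with zero initial state and almost everywhere zero control vanishes. -/
theorem eq_zero (h : IsTrajectory A B T 0 x₁ u x) (hT : 0 ≤ T)
    (hu : ∀ᵐ t ∂volume.restrict (Ioc 0 T), u t = 0) : ∀ t ∈ Icc 0 T, x t = 0 := by
  intro t ht
  refine ext_inner_left ℝ fun v => ?_
  set p : ℝ → Vec n := fun s => flow (actL A).adjoint (t - s) v with hpdef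
  have hp : ∀ s, HasDerivAt p (-((actL A).adjoint (p s))) s := by
    intro s
    have h1 := (hasDerivAt_flow (actL A).adjoint (t - s)).scomp s ((hasDerivAt_id s).const_sub t)
    refine (h1.clm_apply (hasDerivAt_const s v)).congr_deriv ?_
    simp [hpdef]
  have hpc : Continuous p := continuous_iff_continuousAt.2 fun s => (hp s).continuousAt
  have h1 := h.integral_costate hT ht hp ((actL A).adjoint.continuous.comp hpc).neg
  have h2 : ∫ s in (0 : ℝ)..t, (⟪-((actL A).adjoint (p s)), x s⟫_ℝ +
      ⟪p s, act A (x s) + act B (u s)⟫_ℝ) = ∫ s in (0 : ℝ)..t, (0 : ℝ) := by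
    refine intervalIntegral.integral_congr_ae ?_
    rw [uIoc_of_le ht.1]
    rw [ae_restrict_iff' measurableSet_Ioc] at hu
    filter_upwards [hu] with s hs hst
    rw [hs ⟨hst.1, hst.2.trans ht.2⟩, map_zero, add_zero, inner_neg_left,
      ContinuousLinearMap.adjoint_inner_left]
    exact neg_add_cancel _
  rw [h2, inner_zero_right, sub_zero, intervalIntegral.integral_zero] at h1
  rw [inner_zero_right]
  simpa [hpdef] using h1.symm

end IsTrajectory

theorem isTrajectory_of_hasDerivAt (hu : Continuous u)
    (hx : ∀ t, HasDerivAt x (act A (x t) + act B (u t)) t) :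
    IsTrajectory A B T (x 0) (x T) u x := by
  have hxc : Continuous x := continuous_iff_continuousAt.2 fun s => (hx s).continuousAt
  have hrhs : Continuous fun t => act A (x t) + act B (u t) :=
    ((actL A).continuous.comp hxc).add ((actL B).continuous.comp hu)
  refine ⟨?_, hxc.continuousOn, fun t _ => ?_, rfl⟩
  · obtain ⟨c, hc⟩ := (isCompact_Icc (a := (0 : ℝ)) (b := T)).exists_bound_of_continuousOn
      hu.continuousOn
    refine MemLp.of_bound hu.aestronglyMeasurable c ?_
    exact (ae_restrict_iff' measurableSet_Icc).2 (Filter.Eventually.of_forall hc)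
  · rw [intervalIntegral.integral_eq_sub_of_hasDerivAt (fun s _ => hx s)
      (hrhs.intervalIntegrable _ _)]
    abel

/-- A solution of the Hamiltonian system is the only optimal pair, by convexity. -/
theorem IsOptimalPair.eq_of_hamiltonian (h : IsOptimalPair A B C z T x₀ x₁ u x) (hT : 0 ≤ T)
    {v : ℝ → Vec m} {y p p' : ℝ → Vec n} (hvy : IsTrajectory A B T x₀ x₁ v y)
    (hp : ∀ t, HasDerivAt p (p' t) t) (hp' : Continuous p')
    (hpeq : ∀ t, p' t = -act A.transpose (p t) - act C.transpose (act C (y t) - z))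
    (hv : ∀ t, v t = -act B.transpose (p t)) :
    u =ᵐ[volume.restrict (Icc 0 T)] v ∧ ∀ t ∈ Icc 0 T, x t = y t := by
  have hd := h.1.sub hvy hT
  rw [sub_self, sub_self] at hd
  have hgreen := hd.integral_costate hT ⟨hT, le_rfl⟩ hp hp'
  rw [hd.endpoint, inner_zero_right, inner_zero_right, sub_zero] at hgreen
  have hpt : ∀ s, ⟪p' s, x s - y s⟫_ℝ + ⟪p s, act A (x s - y s) + act B (u s - v s)⟫_ℝ =
      -(⟪act C (y s) - z, act C (x s - y s)⟫_ℝ + ⟪v s, u s - v s⟫_ℝ) := by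
    intro s
    rw [hpeq, hv, inner_sub_left, inner_neg_left, inner_neg_left, inner_act_transpose,
      inner_act_transpose, inner_act_transpose, inner_add_right]
    ring
  simp only [hpt] at hgreen
  rw [intervalIntegral.integral_neg, neg_eq_zero] at hgreen
  -- The cost is quadratic, so this expansion is exact; its cross term integrates to zero by Green's
  -- formula, since the difference of the trajectories vanishes at both ends.
  have hexp : ∀ s, ‖u s - v s‖ ^ 2 + ‖act C (x s - y s) - 0‖ ^ 2 =
      (‖u s‖ ^ 2 + ‖act C (x s) - z‖ ^ 2) - (‖v s‖ ^ 2 + ‖act C (y s) - z‖ ^ 2) -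
        2 * (⟪act C (y s) - z, act C (x s - y s)⟫_ℝ + ⟪v s, u s - v s⟫_ℝ) := by
    intro s
    have h1 : u s = v s + (u s - v s) := by abel
    have h2 : act C (x s) - z = (act C (y s) - z) + act C (x s - y s) := by
      rw [map_sub]; abel
    have h3 := norm_add_sq_real (v s) (u s - v s)
    have h4 := norm_add_sq_real (act C (y s) - z) (act C (x s - y s))
    rw [← h1] at h3
    rw [← h2] at h4
    rw [sub_zero]
    linarith
  have i1 := h.1.intervalIntegrable_cost hT C z
  have i2 := hvy.intervalIntegrable_cost hT C z
  have i3 := hd.intervalIntegrable_cost hT C 0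
  have i4 : IntervalIntegrable (fun s => 2 * (⟪act C (y s) - z, act C (x s - y s)⟫_ℝ +
      ⟪v s, u s - v s⟫_ℝ)) volume 0 T := by
    refine ((i1.sub i2).sub i3).congr ?_
    intro s _
    simp only
    rw [hexp]; ring
  have hle : ∫ s in (0 : ℝ)..T, (‖u s - v s‖ ^ 2 + ‖act C (x s - y s) - 0‖ ^ 2) ≤ 0 := by
    simp only [hexp]
    rw [intervalIntegral.integral_sub (i1.sub i2) i4, intervalIntegral.integral_sub i1 i2,
      intervalIntegral.integral_const_mul, hgreen]
    have := h.2 v y hvy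
    simp only [cost] at this
    linarith
  have hnn : ∀ s, 0 ≤ ‖u s - v s‖ ^ 2 + ‖act C (x s - y s) - 0‖ ^ 2 := fun s => by positivity
  have hae := (intervalIntegral.integral_eq_zero_iff_of_le_of_nonneg_ae hT
    (Filter.Eventually.of_forall hnn) i3).1
    (le_antisymm hle (intervalIntegral.integral_nonneg_of_forall hT hnn))
  have hw : ∀ᵐ s ∂volume.restrict (Ioc 0 T), u s - v s = 0 := by
    filter_upwards [hae] with s hs
    have h1 : ‖u s - v s‖ ^ 2 + ‖act C (x s - y s) - 0‖ ^ 2 = 0 := hs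
    have h2 : ‖u s - v s‖ ^ 2 = 0 := by
      linarith [sq_nonneg ‖u s - v s‖, sq_nonneg ‖act C (x s - y s) - 0‖]
    simpa using h2
  refine ⟨?_, fun t ht => sub_eq_zero.1 (hd.eq_zero hT hw t ht)⟩
  rw [Measure.restrict_congr_set Ioc_ae_eq_Icc.symm]
  filter_upwards [hw] with s hs using sub_eq_zero.1 hs

/-- Steer `0` to `q` in time `1` and pair with the adjoint solution `p` ending at `q`. If `B* p =
0`, neither the control nor the feedback term `B K` contributes, so `⟪p, x⟫` is constant and `⟪q, q⟫
= 0`. -/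
theorem IsControllable.isAdjointObservable (h : IsControllable A B)
    (K : Matrix (Fin m) (Fin n) ℝ) : IsAdjointObservable (actL (A - B * K)) (actL B) := by
  intro q hq
  obtain ⟨u, x, hux⟩ := h 1 one_pos 0 q
  set M := actL (A - B * K) with hM
  set p : ℝ → Vec n := fun s => flow M.adjoint (1 - s) q with hpdef
  have hp : ∀ s, HasDerivAt p (-(M.adjoint (p s))) s := by
    intro s
    have h1 := (hasDerivAt_flow M.adjoint (1 - s)).scomp s ((hasDerivAt_id s).const_sub 1)
    refine (h1.clm_apply (hasDerivAt_const s q)).congr_deriv ?_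
    simp [hpdef]
  have hpc : Continuous p := continuous_iff_continuousAt.2 fun s => (hp s).continuousAt
  have h1 := hux.integral_costate zero_le_one ⟨zero_le_one, le_rfl⟩ hp
    (M.adjoint.continuous.comp hpc).neg
  have h2 : ∫ s in (0 : ℝ)..1, (⟪-(M.adjoint (p s)), x s⟫_ℝ +
      ⟪p s, act A (x s) + act B (u s)⟫_ℝ) = ∫ s in (0 : ℝ)..1, (0 : ℝ) := by
    refine intervalIntegral.integral_congr fun s hs => ?_
    rw [uIcc_of_le zero_le_one] at hs
    have hBp : act B.transpose (p s) = 0 := by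
      have h3 := hq (1 - s) ⟨by linarith [hs.2], by linarith [hs.1]⟩
      rw [ContinuousLinearMap.adjoint_comp, adjoint_flow, adjoint_actL B] at h3
      exact h3
    have hMx : M (x s) = act A (x s) - act B (act K (x s)) := by
      rw [← act_mul, ← LinearMap.sub_apply, ← act_sub]
      rfl
    show ⟪-(M.adjoint (p s)), x s⟫_ℝ + ⟪p s, act A (x s) + act B (u s)⟫_ℝ = 0
    rw [inner_neg_left, ContinuousLinearMap.adjoint_inner_left, hMx, inner_sub_right,
      inner_add_right, ← inner_act_transpose B, ← inner_act_transpose B, hBp, inner_zero_left,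
      inner_zero_left]
    ring
  rw [h2, intervalIntegral.integral_zero, inner_zero_right, sub_zero, hux.endpoint] at h1
  simpa [hpdef] using h1.symm

end Trajectories

/-! ### The steady problem: first order conditions, existence, multiplier, uniqueness. -/

section Steady

variable {n m : ℕ} {A : Matrix (Fin n) (Fin n) ℝ} {B : Matrix (Fin n) (Fin m) ℝ}
  {C : Matrix (Fin n) (Fin n) ℝ} {z : Vec n}

theorem mem_steadyArgmin_of_inner {w : WithLp 2 (Vec m × Vec n)}
    (hw : act A w.snd + act B w.fst = 0)
    (h : ∀ (y : Vec n) (v : Vec m), act A y + act B v = 0 →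
      ⟪w.fst, v⟫_ℝ + ⟪act C w.snd - z, act C y⟫_ℝ = 0) : w ∈ steadyArgmin A B C z := by
  refine ⟨hw, fun w' hw' => ?_⟩
  have h1 := h (w'.snd - w.snd) (w'.fst - w.fst) (by
    rw [map_sub, map_sub, sub_add_sub_comm, hw, hw', sub_zero])
  have h2 := norm_add_sq_real w.fst (w'.fst - w.fst)
  have h3 := norm_add_sq_real (act C w.snd - z) (act C (w'.snd - w.snd))
  rw [add_sub_cancel] at h2
  rw [show act C w.snd - z + act C (w'.snd - w.snd) = act C w'.snd - z by
    rw [map_sub]; abel] at h3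
  rw [steadyCost, steadyCost, h2, h3]
  nlinarith [sq_nonneg ‖w'.fst - w.fst‖, sq_nonneg ‖act C (w'.snd - w.snd)‖]

theorem inner_eq_zero_of_mem_steadyArgmin {w : WithLp 2 (Vec m × Vec n)}
    (hw : w ∈ steadyArgmin A B C z) {y : Vec n} {v : Vec m} (hyv : act A y + act B v = 0) :
    ⟪w.fst, v⟫_ℝ + ⟪act C w.snd - z, act C y⟫_ℝ = 0 := by
  set s := ⟪w.fst, v⟫_ℝ + ⟪act C w.snd - z, act C y⟫_ℝ with hs
  set a := ‖v‖ ^ 2 + ‖act C y‖ ^ 2 with ha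
  have ha0 : 0 ≤ a := by positivity
  have key : ∀ t : ℝ, 0 ≤ 2 * t * s + t ^ 2 * a := by
    intro t
    have h1 := hw.2 (WithLp.toLp 2 (w.fst + t • v, w.snd + t • y)) (by
      show act A (w.snd + t • y) + act B (w.fst + t • v) = 0
      have : act A w.snd + act B w.fst + t • (act A y + act B v) = 0 := by
        rw [hw.1, hyv, smul_zero, add_zero]
      rw [← this, map_add, map_add, map_smul, map_smul]
      module)
    have h2 := norm_add_sq_real w.fst (t • v)
    have h3 := norm_add_sq_real (act C w.snd - z) (t • act C y)
    rw [inner_smul_right, norm_smul, mul_pow, Real.norm_eq_abs, sq_abs] at h2 h3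
    have h4 : act C (w.snd + t • y) - z = act C w.snd - z + t • act C y := by
      rw [map_add, map_smul]; abel
    replace h1 : 1 / 2 * (‖w.fst‖ ^ 2 + ‖act C w.snd - z‖ ^ 2) ≤
        1 / 2 * (‖w.fst + t • v‖ ^ 2 + ‖act C (w.snd + t • y) - z‖ ^ 2) := h1
    rw [h4, h2, h3] at h1
    nlinarith
  by_contra hne
  -- Near-optimal step length; `a + 1` instead of `a` avoids the degenerate case `a = 0`.
  have h1 := key (-s / (a + 1))
  have h2 : 2 * (-s / (a + 1)) * s + (-s / (a + 1)) ^ 2 * a =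
      -(s ^ 2 * (a + 2) / (a + 1) ^ 2) := by
    field_simp
    ring
  rw [h2] at h1
  have h3 : 0 < s ^ 2 * (a + 2) / (a + 1) ^ 2 := by
    have := sq_pos_of_ne_zero hne
    positivity
  linarith

/-- Project `(0, z)` onto the finite-dimensional space of pairs `(u, C x)` with `(x, u)` feasible.
No coercivity in `x` is needed. -/
theorem steadyArgmin_nonempty (A : Matrix (Fin n) (Fin n) ℝ) (B : Matrix (Fin n) (Fin m) ℝ)
    (C : Matrix (Fin n) (Fin n) ℝ) (z : Vec n) : (steadyArgmin A B C z).Nonempty := by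
  let f : (Vec n × Vec m) →ₗ[ℝ] Vec n :=
    (act A).comp (LinearMap.fst ℝ _ _) + (act B).comp (LinearMap.snd ℝ _ _)
  let g : (Vec n × Vec m) →ₗ[ℝ] WithLp 2 (Vec m × Vec n) :=
    (WithLp.linearEquiv 2 ℝ (Vec m × Vec n)).symm.toLinearMap.comp
      ((LinearMap.snd ℝ _ _).prod ((act C).comp (LinearMap.fst ℝ _ _)))
  let W := (LinearMap.ker f).map g
  obtain ⟨⟨y, v⟩, hyv, hgyv⟩ := W.starProjection_apply_mem (WithLp.toLp 2 (0, z))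
  refine ⟨WithLp.toLp 2 (v, y), mem_steadyArgmin_of_inner hyv fun y' v' hyv' => ?_⟩
  have h1 := W.starProjection_inner_eq_zero (WithLp.toLp 2 (0, z)) (g (y', v')) ⟨(y', v'), hyv', rfl⟩
  rw [← hgyv, WithLp.prod_inner_apply] at h1
  simp only [g] at h1
  have h2 : ⟪(0 : Vec m) - v, v'⟫_ℝ + ⟪z - act C y, act C y'⟫_ℝ = 0 := h1
  show ⟪v, v'⟫_ℝ + ⟪act C y - z, act C y'⟫_ℝ = 0
  rw [inner_sub_left, inner_zero_left] at h2
  rw [inner_sub_left] at h2 ⊢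
  linarith

/-- Lagrange multiplier of the steady problem. -/
theorem exists_multiplier {w : WithLp 2 (Vec m × Vec n)} (hw : w ∈ steadyArgmin A B C z) :
    ∃ p : Vec n, w.fst = -act B.transpose p ∧
      act A.transpose p + act C.transpose (act C w.snd - z) = 0 := by
  let f : WithLp 2 (Vec m × Vec n) →ₗ[ℝ] Vec n :=
    ((act B).comp (LinearMap.fst ℝ _ _) + (act A).comp (LinearMap.snd ℝ _ _)).comp
      (WithLp.linearEquiv 2 ℝ (Vec m × Vec n)).toLinearMap
  have hmem : WithLp.toLp 2 (w.fst, act C.transpose (act C w.snd - z)) ∈ (LinearMap.ker f)ᗮ := by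
    rw [Submodule.mem_orthogonal']
    intro d hd
    have hd' : act B d.fst + act A d.snd = 0 := hd
    rw [WithLp.prod_inner_apply]
    show ⟪w.fst, d.fst⟫_ℝ + ⟪act C.transpose (act C w.snd - z), d.snd⟫_ℝ = 0
    rw [inner_act_transpose]
    exact inner_eq_zero_of_mem_steadyArgmin hw (by rw [add_comm]; exact hd')
  rw [LinearMap.orthogonal_ker] at hmem
  obtain ⟨p, hp⟩ := hmem
  have hadj : f.adjoint p = WithLp.toLp 2 (act B.transpose p, act A.transpose p) := by
    refine ext_inner_right ℝ fun d => ?_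
    rw [LinearMap.adjoint_inner_left, WithLp.prod_inner_apply]
    show ⟪p, act B d.fst + act A d.snd⟫_ℝ =
      ⟪act B.transpose p, d.fst⟫_ℝ + ⟪act A.transpose p, d.snd⟫_ℝ
    rw [inner_act_transpose, inner_act_transpose, inner_add_right]
  rw [hadj] at hp
  have h1 : act B.transpose p = w.fst := congrArg WithLp.fst hp
  have h2 : act A.transpose p = act C.transpose (act C w.snd - z) := congrArg WithLp.snd hp
  refine ⟨-p, ?_, ?_⟩
  · rw [map_neg, neg_neg, h1]
  · rw [map_neg, h2, neg_add_cancel]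

/-- The cost is strictly convex in `(u, C x)`, so minimizers differ only in `ker A ∩ ker C`. -/
theorem steadyArgmin_unique {w w' : WithLp 2 (Vec m × Vec n)} (hw : w ∈ steadyArgmin A B C z)
    (hw' : w' ∈ steadyArgmin A B C z) :
    w'.fst = w.fst ∧ act A (w'.snd - w.snd) = 0 ∧ act C (w'.snd - w.snd) = 0 := by
  have hfeas : act A (w'.snd - w.snd) + act B (w'.fst - w.fst) = 0 := by
    rw [map_sub, map_sub, sub_add_sub_comm, hw.1, hw'.1, sub_zero]
  have h1 := inner_eq_zero_of_mem_steadyArgmin hw hfeas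
  have h2 := inner_eq_zero_of_mem_steadyArgmin hw' hfeas
  have h3 : ‖w'.fst - w.fst‖ ^ 2 + ‖act C (w'.snd - w.snd)‖ ^ 2 = 0 := by
    rw [← real_inner_self_eq_norm_sq, ← real_inner_self_eq_norm_sq]
    conv_lhs => rw [inner_sub_left, map_sub, inner_sub_left]
    rw [map_sub] at h1 h2
    rw [inner_sub_left] at h1 h2
    linarith
  have h4 : ‖w'.fst - w.fst‖ ^ 2 = 0 := by nlinarith [sq_nonneg ‖act C (w'.snd - w.snd)‖]
  have h5 : ‖act C (w'.snd - w.snd)‖ ^ 2 = 0 := by nlinarith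
  have h6 : w'.fst - w.fst = 0 := by simpa using h4
  rw [h6, map_zero, add_zero] at hfeas
  exact ⟨sub_eq_zero.1 h6, hfeas, by simpa using h5⟩

theorem steadyArgmin_add {w : WithLp 2 (Vec m × Vec n)} (hw : w ∈ steadyArgmin A B C z)
    {d : Vec n} (hA : act A d = 0) (hC : act C d = 0) :
    WithLp.toLp 2 (w.fst, w.snd + d) ∈ steadyArgmin A B C z := by
  refine ⟨?_, fun w' hw' => ?_⟩
  · show act A (w.snd + d) + act B w.fst = 0
    rw [map_add, hA, add_zero, hw.1]
  · refine le_trans (le_of_eq ?_) (hw.2 w' hw')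
    show 1 / 2 * (‖w.fst‖ ^ 2 + ‖act C (w.snd + d) - z‖ ^ 2) = _
    rw [map_add, hC, add_zero]
    rfl

end Steady

/-! ### Uniform constants and the link between optimal pairs and the closed loop. -/

section Synthesis

variable {n m : ℕ}

/-- The left side equals `⟪q, P B B* P* q⟫`, and `T P B B* P* q` is the drift over the whole
interval, which the fixed endpoints keep bounded. -/
theorem norm_adjoint_sq_le {P : Vec n →L[ℝ] Vec n} (B : Vec m →L[ℝ] Vec n) {T s : ℝ} (hT : 0 < T) {q a b : Vec n}
    (hs : ‖P (b - (a - T • B (B.adjoint (P.adjoint q))))‖ ≤ s) :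
    ‖B.adjoint (P.adjoint q)‖ ^ 2 ≤ ‖q‖ * (s + ‖P‖ * (‖a‖ + ‖b‖)) / T := by
  set g := B (B.adjoint (P.adjoint q)) with hg
  have h1 : ‖B.adjoint (P.adjoint q)‖ ^ 2 = ⟪q, P g⟫_ℝ := by
    rw [← real_inner_self_eq_norm_sq, ContinuousLinearMap.adjoint_inner_left,
      ContinuousLinearMap.adjoint_inner_left]
  have h2 : T * ‖P g‖ ≤ s + ‖P‖ * (‖a‖ + ‖b‖) := by
    have h3 : T • P g = P (b - (a - T • g)) + P (a - b) := by
      rw [← map_add, ← map_smul]; congr 1; abel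
    calc T * ‖P g‖ = ‖T • P g‖ := by rw [norm_smul, Real.norm_of_nonneg hT.le]
      _ ≤ s + ‖P‖ * (‖a‖ + ‖b‖) := by
          rw [h3]
          refine (norm_add_le _ _).trans (add_le_add hs ?_)
          refine (ContinuousLinearMap.le_opNorm _ _).trans ?_
          gcongr
          exact norm_sub_le _ _
  rw [h1, le_div_iff₀ hT]
  calc _ ≤ ‖q‖ * ‖P g‖ * T := by gcongr; exact real_inner_le_norm _ _
    _ = ‖q‖ * (T * ‖P g‖) := by ring
    _ ≤ _ := by gcongr

/-- Turnpike estimates for the boundary value problem, with a constant independent of `T`. -/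
theorem ExpDichotomy.exists_uniform_bound {M P Q : Vec n →L[ℝ] Vec n} {k μ : ℝ}
    (h : ExpDichotomy M P Q k μ) {R : Vec n →L[ℝ] Vec n} (hMR : M * R = Q) (hPR : P * R = 0)
    (B : Vec m →L[ℝ] Vec n) (F : Vec n →L[ℝ] Vec m) (hFP : ∀ x, F (P x) = 0) {c : ℝ} (hc : 0 < c)
    (a b : Vec n) :
    ∃ K : ℝ, 0 < K ∧ ∀ T : ℝ, 0 < T → ∀ (q : Vec n) (y : ℝ → Vec n),
      (∀ t, HasDerivAt y (M (y t) - B (B.adjoint ((flow M (T - t)).adjoint q))) t) →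
      y 0 = a → y T = b → c * ‖q‖ ≤ ‖flow M T a - b‖ →
      (∀ t ∈ Icc 0 T,
        ‖F (y t - R (B (B.adjoint (P.adjoint q)))) +
            B.adjoint ((flow M (T - t)).adjoint q - P.adjoint q)‖ +
          ‖Q (y t) - R (B (B.adjoint (P.adjoint q)))‖ ≤
            K * (Real.exp (-μ * t) + Real.exp (-μ * (T - t))) ∧
        ‖F (y t - R (B (B.adjoint (P.adjoint q)))) +
            B.adjoint ((flow M (T - t)).adjoint q - P.adjoint q)‖ +
          ‖P (y t - (a - t • B (B.adjoint (P.adjoint q))))‖ ≤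
            K * (Real.exp (-μ * t) + Real.exp (-μ * (T - t)))) ∧
      ‖F (R (B (B.adjoint (P.adjoint q)))) + B.adjoint (P.adjoint q)‖ ^ 2 +
        ‖R (B (B.adjoint (P.adjoint q)))‖ ^ 2 ≤ K / T := by
  obtain ⟨L, hL, hbound⟩ := h.exists_turnpike_bound hMR hPR B
  have hk := h.k_pos
  -- `N` bounds `‖q‖`, `K₁` the transient, and `K₂` the `1 / T` term; none involves `T`.
  obtain ⟨N, hN⟩ : ∃ N, N = ((‖P‖ + k) * ‖a‖ + ‖b‖) / c := ⟨_, rfl⟩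
  have hN0 : 0 ≤ N := by rw [hN]; positivity
  obtain ⟨K₁, hK₁⟩ : ∃ K₁, K₁ = ‖F‖ * (L * (‖a‖ + N)) + ‖B‖ * (k * N) + L * (‖a‖ + N) := ⟨_, rfl⟩
  have hK₁0 : 0 ≤ K₁ := by rw [hK₁]; positivity
  obtain ⟨D, hD⟩ : ∃ D, D = (‖F‖ * (‖R‖ * ‖B‖) + 1) ^ 2 + (‖R‖ * ‖B‖) ^ 2 := ⟨_, rfl⟩
  have hD0 : 0 ≤ D := by rw [hD]; positivity
  obtain ⟨K₂, hK₂⟩ : ∃ K₂, K₂ = D * (N * (L * N + ‖P‖ * (‖a‖ + ‖b‖))) := ⟨_, rfl⟩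
  have hK₂0 : 0 ≤ K₂ := by rw [hK₂]; positivity
  refine ⟨K₁ + K₂ + 1, by positivity, fun T hT q y hy hya hyb hq => ?_⟩
  have hqN : ‖q‖ ≤ N := by
    rw [hN, le_div_iff₀ hc, mul_comm]
    refine hq.trans ((norm_sub_le _ _).trans (add_le_add ?_ le_rfl))
    refine (ContinuousLinearMap.le_opNorm _ _).trans ?_
    gcongr
    exact h.norm_flow_le hT.le
  have hb := hbound T q y hy
  rw [hya] at hb
  constructor
  · intro t ht
    obtain ⟨b1, b2⟩ := hb t ht
    have b3 := h.norm_adjoint_flow_sub_le (t := T - t) (by linarith [ht.2]) q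
    have he1 := Real.exp_pos (-μ * t)
    have he2 := Real.exp_pos (-μ * (T - t))
    generalize Real.exp (-μ * t) = e1 at *
    generalize Real.exp (-μ * (T - t)) = e2 at *
    have hadd : P (y t) + Q (y t) = y t := congrArg (fun L => L (y t)) h.add_eq_one
    have c1 : ‖Q (y t) - R (B (B.adjoint (P.adjoint q)))‖ ≤ L * (‖a‖ + N) * (e1 + e2) :=
      b1.trans (by gcongr)
    have c2 : ‖P (y t - (a - t • B (B.adjoint (P.adjoint q))))‖ ≤ L * (‖a‖ + N) * (e1 + e2) := by
      refine b2.trans ?_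
      gcongr
      · linarith [norm_nonneg a]
      · linarith
    have c3 : ‖F (y t - R (B (B.adjoint (P.adjoint q)))) +
        B.adjoint ((flow M (T - t)).adjoint q - P.adjoint q)‖ ≤
          (‖F‖ * (L * (‖a‖ + N)) + ‖B‖ * (k * N)) * (e1 + e2) := by
      -- The feedback vanishes on the range of `P`, so the unbounded drift does not enter the
      -- control.
      have e : F (y t - R (B (B.adjoint (P.adjoint q)))) =
          F (Q (y t) - R (B (B.adjoint (P.adjoint q)))) := by
        conv_lhs => rw [← hadd, add_sub_assoc, map_add, hFP, zero_add]
      rw [e]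
      calc _ ≤ ‖F‖ * (L * (‖a‖ + N) * (e1 + e2)) + ‖B‖ * (k * N * (e1 + e2)) := by
            refine (norm_add_le _ _).trans (add_le_add ?_ ?_)
            · refine (ContinuousLinearMap.le_opNorm _ _).trans ?_
              gcongr
            · refine (ContinuousLinearMap.le_opNorm _ _).trans ?_
              rw [LinearIsometryEquiv.norm_map]
              gcongr
              refine b3.trans ?_
              rw [mul_right_comm]
              gcongr
              linarith
        _ = _ := by ring
    have hee : 0 ≤ (K₂ + 1) * (e1 + e2) := by positivity
    constructor <;> rw [hK₁] <;> linarith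
  · have hT2 := (hb T ⟨hT.le, le_rfl⟩).2
    rw [sub_self, mul_zero, Real.exp_zero, mul_one, hyb] at hT2
    have hsq := norm_adjoint_sq_le B hT hT2
    set v := B.adjoint (P.adjoint q) with hv
    have hRB : ‖R (B v)‖ ≤ ‖R‖ * ‖B‖ * ‖v‖ := by
      rw [mul_assoc]
      refine (ContinuousLinearMap.le_opNorm _ _).trans ?_
      gcongr
      exact ContinuousLinearMap.le_opNorm _ _
    have hF : ‖F (R (B v)) + v‖ ≤ (‖F‖ * (‖R‖ * ‖B‖) + 1) * ‖v‖ := by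
      rw [add_mul, one_mul, mul_assoc]
      refine (norm_add_le _ _).trans (add_le_add ?_ le_rfl)
      refine (ContinuousLinearMap.le_opNorm _ _).trans ?_
      gcongr
    calc _ ≤ ((‖F‖ * (‖R‖ * ‖B‖) + 1) * ‖v‖) ^ 2 + (‖R‖ * ‖B‖ * ‖v‖) ^ 2 := by gcongr
      _ = D * ‖v‖ ^ 2 := by rw [hD]; ring
      _ ≤ D * (‖q‖ * (L * ‖q‖ + ‖P‖ * (‖a‖ + ‖b‖)) / T) := by gcongr
      _ ≤ D * (N * (L * N + ‖P‖ * (‖a‖ + ‖b‖)) / T) := by gcongr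
      _ = K₂ / T := by rw [hK₂, mul_div_assoc, mul_div_assoc, mul_div_assoc]
      _ ≤ _ := by gcongr; linarith

variable {A : Matrix (Fin n) (Fin n) ℝ} {B : Matrix (Fin n) (Fin m) ℝ}
  {C E : Matrix (Fin n) (Fin n) ℝ}

namespace IsAntistrongSolution

theorem act_closedLoop_transpose (hE : IsAntistrongSolution A B C E) (x : Vec n) :
    act (closedLoop A B E).transpose x =
      act A.transpose x - act E (act B (act B.transpose x)) := by
  rw [← act_mul, ← act_mul, ← LinearMap.sub_apply, ← act_sub, closedLoop, Matrix.transpose_sub,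
    Matrix.transpose_mul, Matrix.transpose_mul, Matrix.transpose_transpose, hE.transpose_eq,
    Matrix.mul_assoc]

/-- Optimal pairs in terms of the closed loop boundary value problem. -/
theorem optimal_eq (hE : IsAntistrongSolution A B C E) {T : ℝ} (hT : 0 ≤ T) {x₀ x₁ z : Vec n}
    {u : ℝ → Vec m} {x : ℝ → Vec n} (hux : IsOptimalPair A B C z T x₀ x₁ u x)
    {w : WithLp 2 (Vec m × Vec n)} (hw : w ∈ steadyArgmin A B C z) {q : Vec n} {y : ℝ → Vec n}
    (hy : ∀ t, HasDerivAt y (actL (closedLoop A B E) (y t) - actL B ((actL B).adjoint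
      ((flow (actL (closedLoop A B E)) (T - t)).adjoint q))) t)
    (hy0 : y 0 = x₀ - w.snd) (hyT : y T = x₁ - w.snd) :
    (u =ᵐ[volume.restrict (Icc 0 T)] fun t => w.fst - act (B.transpose * E) (y t) -
      act B.transpose ((flow (actL (closedLoop A B E)) (T - t)).adjoint q)) ∧
    ∀ t ∈ Icc 0 T, x t = y t + w.snd := by
  obtain ⟨p₀, hp₀, hp₀'⟩ := exists_multiplier hw
  set M := actL (closedLoop A B E) with hM
  set r : ℝ → Vec n := fun t => (flow M (T - t)).adjoint q with hr
  have hrd : ∀ t, HasDerivAt r (-(act (closedLoop A B E).transpose (r t))) t := by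
    intro t
    have h1 := (hasDerivAt_flow M.adjoint (T - t)).scomp t ((hasDerivAt_id t).const_sub T)
    have h2 := h1.clm_apply (hasDerivAt_const t q)
    have h3 : r = fun t => flow M.adjoint (T - t) q := by
      funext t; rw [hr, ← adjoint_flow]
    rw [h3]
    refine h2.congr_deriv ?_
    rw [neg_one_smul, map_zero, add_zero, hM, adjoint_actL]
    rfl
  have hyc : Continuous y := continuous_iff_continuousAt.2 fun s => (hy s).continuousAt
  have hrc : Continuous r := continuous_iff_continuousAt.2 fun s => (hrd s).continuousAt
  replace hy : ∀ t, HasDerivAt y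
      (act (closedLoop A B E) (y t) - act B (act B.transpose (r t))) t := by
    intro t
    have := hy t
    rw [adjoint_actL] at this
    exact this
  set v : ℝ → Vec m := fun t => w.fst - act (B.transpose * E) (y t) - act B.transpose (r t) with hv
  have hvc : Continuous v :=
    (continuous_const.sub ((actL (B.transpose * E)).continuous.comp hyc)).sub
      ((actL B.transpose).continuous.comp hrc)
  have htraj : IsTrajectory A B T x₀ x₁ v (fun t => y t + w.snd) := by
    have h1 := isTrajectory_of_hasDerivAt (A := A) (B := B) (T := T) (u := v)
      (x := fun t => y t + w.snd) hvc fun t => by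
        refine ((hy t).add_const w.snd).congr_deriv ?_
        have h2 : act A w.snd = -act B w.fst := eq_neg_of_add_eq_zero_left hw.1
        rw [act_closedLoop, map_add, h2]
        simp only [hv, map_sub]
        abel
    simpa only [hy0, hyT, sub_add_cancel] using h1
  -- Decoupling ansatz: steady multiplier, Riccati feedback, and a free solution of the adjoint
  -- closed loop equation.
  set p : ℝ → Vec n := fun t => p₀ + act E (y t) + r t with hpdef
  have hp : ∀ t, HasDerivAt p
      (-act A.transpose (p t) - act C.transpose (act C (y t + w.snd) - z)) t := by
    intro t
    have h1 := ((actL E).hasFDerivAt.comp_hasDerivAt t (hy t)).const_add p₀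
    refine (h1.add (hrd t)).congr_deriv ?_
    have h2 : actL E (act (closedLoop A B E) (y t) - act B (act B.transpose (r t))) =
        act E (act (closedLoop A B E) (y t)) - act E (act B (act B.transpose (r t))) := map_sub _ _ _
    rw [h2, hE.act_riccati, hE.act_closedLoop_transpose, ← sub_eq_zero, ← hp₀']
    simp only [hpdef, map_add, map_sub]
    abel
  have hpc : Continuous p := continuous_iff_continuousAt.2 fun s => (hp s).continuousAt
  refine hux.eq_of_hamiltonian hT htraj hp ?_ (fun _ => rfl) fun t => ?_
  · exact (((actL A.transpose).continuous.comp hpc).neg).sub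
      ((actL C.transpose).continuous.comp
        (((actL C).continuous.comp (hyc.add continuous_const)).sub continuous_const))
  · simp only [hv, hpdef, map_add, act_mul, hp₀]
    abel

theorem exists_expDichotomy (hE : IsAntistrongSolution A B C E)
    (hNO : NO0 C A ≤ LinearMap.ker (act A)) :
    ∃ k μ : ℝ, ExpDichotomy (actL (closedLoop A B E))
      (LinearMap.toContinuousLinearMap (Submodule.projection _ _
        (hE.isCompl_NO0_stableSubspace hNO)))
      (LinearMap.toContinuousLinearMap (Submodule.projection _ _
        (hE.isCompl_NO0_stableSubspace hNO).symm)) k μ := by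
  have hc := hE.isCompl_NO0_stableSubspace hNO
  obtain ⟨μ, hμ, k, hk, hdecay⟩ := exists_norm_flow_comp_le (closedLoop A B E)
    (LinearMap.toContinuousLinearMap (Submodule.projection _ _ hc.symm))
    fun x => Submodule.projection_apply_mem hc.symm x
  refine ⟨k, μ, ?_, ?_, ?_, ?_, hk, hμ, hdecay⟩
  · ext1 x
    exact Submodule.projection_add_projection_eq_self hc x
  · ext1 x
    exact (hE.closedLoop_eq_zero_iff hNO _).2 (Submodule.projection_apply_mem hc x)
  · ext1 x
    refine (Submodule.projection_apply_eq_zero_iff hc).2 ?_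
    rw [← hE.range_closedLoop hNO]
    exact ⟨x, rfl⟩
  · ext1 x
    exact (Submodule.projection_apply_eq_zero_iff hc).2 (Submodule.projection_apply_mem hc.symm x)

end IsAntistrongSolution
end Synthesis

end Turnpike

/-! ### The turnpike theorem. -/

open Turnpike in
theorem proposition2p2 {n m : ℕ} (A : Matrix (Fin n) (Fin n) ℝ) (B : Matrix (Fin n) (Fin m) ℝ)
    (C : Matrix (Fin n) (Fin n) ℝ)
    (hAB : Turnpike.IsControllable A B)
    (hNO : Turnpike.NO0 C A ≤ LinearMap.ker (Turnpike.act A))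
    (E : Matrix (Fin n) (Fin n) ℝ) (hE : Turnpike.IsAntistrongSolution A B C E) :
    ∃ hc : IsCompl (Turnpike.NO0 C A) (Turnpike.stableSubspace (A - B * B.transpose * E)),
    ∃ μ : ℝ, 0 < μ ∧
    ∀ x₀ x₁ z : Turnpike.Vec n,
      (Turnpike.steadyArgmin A B C z).Nonempty ∧
      ∃ K : ℝ, 0 < K ∧
      ∀ T : ℝ, 2 < T →
      ∀ (u : ℝ → Turnpike.Vec m) (x : ℝ → Turnpike.Vec n),
        Turnpike.IsOptimalPair A B C z T x₀ x₁ u x →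
        ∃ q' ∈ LinearMap.ker (Turnpike.act (A - B * B.transpose * E).transpose),
        ∃ x' ∈ Turnpike.stableSubspace (A - B * B.transpose * E),
        ∃ u' : Turnpike.Vec m,
          (∀ w ∈ Turnpike.steadyArgmin A B C z,
            u' = w.fst - Turnpike.act (B.transpose * E) (x' - w.snd)
              - Turnpike.act B.transpose q') ∧
          (∃ v : ℝ → Turnpike.Vec m, ContinuousOn v (Set.Icc 0 T) ∧
            u =ᵐ[MeasureTheory.volume.restrict (Set.Icc 0 T)] v ∧
            ∀ t ∈ Set.Icc 0 T,
              ‖v t - u'‖ + ‖Submodule.projection _ _ hc.symm (x t) - x'‖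
                ≤ K * (Real.exp (-μ * t) + Real.exp (-μ * (T - t))) ∧
              ‖v t - u'‖ + ‖Submodule.projection _ _ hc
                  (x t - (x₀ - t • Turnpike.act (B * B.transpose) q'))‖
                ≤ K * (Real.exp (-μ * t) + Real.exp (-μ * (T - t)))) ∧
          Metric.infDist (WithLp.toLp 2 (u', x')) (Turnpike.steadyArgmin A B C z) ^ 2 ≤ K / T := by
  have hc := hE.isCompl_NO0_stableSubspace hNO
  obtain ⟨k, μ, hdich⟩ := hE.exists_expDichotomy hNO
  refine ⟨hc, μ, hdich.μ_pos, fun x₀ x₁ z => ?_⟩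
  have hne := steadyArgmin_nonempty A B C z
  refine ⟨hne, ?_⟩
  obtain ⟨w, hw⟩ := hne
  set M := actL (closedLoop A B E) with hM
  set P : Vec n →L[ℝ] Vec n := LinearMap.toContinuousLinearMap (Submodule.projection _ _ hc)
    with hP
  set Q : Vec n →L[ℝ] Vec n := LinearMap.toContinuousLinearMap (Submodule.projection _ _ hc.symm)
    with hQ
  have hPmem : ∀ y, P y ∈ NO0 C A := fun y => Submodule.projection_apply_mem hc y
  have hPA : ∀ y, act A (P y) = 0 := fun y => hNO (hPmem y)
  have hPC : ∀ y, act C (P y) = 0 := fun y => act_output_eq_zero_of_mem_NO0 (hPmem y)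
  have hPF : ∀ y, act (B.transpose * E) (P y) = 0 := fun y =>
    hE.feedback_eq_zero (hPA y) (hPC y)
  obtain ⟨R, hMR, hPR⟩ := hdich.exists_inverse fun y hy =>
    (Submodule.projection_apply_eq_zero_iff hc.symm).2 ((hE.closedLoop_eq_zero_iff hNO y).1 hy)
  have hobs : IsAdjointObservable M (actL B) := by
    have := hAB.isAdjointObservable (B.transpose * E)
    rwa [← Matrix.mul_assoc] at this
  obtain ⟨c, hc0, hgram⟩ := exists_gramian_coercive hobs
  -- The minimizer `w` is fixed before `T`, so this constant does not see `T`.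
  obtain ⟨K, hK, hbound⟩ := hdich.exists_uniform_bound hMR hPR (actL B) (actL (B.transpose * E))
    hPF hc0 (x₀ - w.snd) (x₁ - w.snd)
  refine ⟨K, hK, fun T hT u x hux => ?_⟩
  obtain ⟨q, y, hy, hy0, hyT, hqle⟩ := exists_boundary_value_solution hc0
    (hgram T (by linarith)) (x₀ - w.snd) (x₁ - w.snd)
  obtain ⟨hest, hdist⟩ := hbound T (by linarith) q y hy hy0 hyT hqle
  obtain ⟨hu, hx⟩ := hE.optimal_eq (by linarith) hux hw hy hy0 hyT
  rw [adjoint_actL B] at hest hdist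
  set q' := P.adjoint q with hq'
  set xs := R (actL B (actL B.transpose q')) with hxs
  have hadd : ∀ y, P y + Q y = y := fun y => congrArg (fun L => L y) hdich.add_eq_one
  -- Undo the shift by `w`: `xs` is the equilibrium of the stable part of `y`, and `Q w.snd` that of
  -- the steady state.
  refine ⟨q', ?_, Q w.snd + xs, ?_, w.fst - act (B.transpose * E) xs - act B.transpose q', ?_,
    ⟨_, ?_, hu, fun t ht => ?_⟩, ?_⟩
  · have h1 : M.adjoint (P.adjoint q) = (P * M).adjoint q := by
      rw [show P * M = P ∘L M from rfl, ContinuousLinearMap.adjoint_comp]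
      rfl
    rw [hdich.mul_right, map_zero, hM, adjoint_actL] at h1
    exact h1
  · refine Submodule.add_mem _ (Submodule.projection_apply_mem hc.symm _) ?_
    have hPR' : ∀ y, P (R y) = 0 := fun y => congrArg (fun L => L y) hPR
    exact (Submodule.projection_apply_eq_zero_iff hc).1 (hPR' _)
  · intro w' hw'
    obtain ⟨h1, h2, h3⟩ := steadyArgmin_unique hw hw'
    -- Up to `xs`, only vectors of `ker A ∩ ker C` remain, and the feedback vanishes there; so `u'`
    -- is the same for every minimizer.
    have h4 : Q w.snd + xs - w'.snd = xs - P w.snd - (w'.snd - w.snd) := by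
      conv_rhs => rw [← hadd w.snd]
      rw [show P (P w.snd + Q w.snd) = P w.snd by rw [hadd]]
      abel
    rw [h4, map_sub, map_sub, hPF, hE.feedback_eq_zero h2 h3, h1, sub_zero, sub_zero]
  · have hyc : Continuous y := continuous_iff_continuousAt.2 fun s => (hy s).continuousAt
    refine Continuous.continuousOn ?_
    refine (continuous_const.sub ((actL (B.transpose * E)).continuous.comp hyc)).sub
      ((actL B.transpose).continuous.comp ?_)
    exact (ContinuousLinearMap.adjoint.continuous.comp ((continuous_flow M).comp
      (continuous_const.sub continuous_id))).clm_apply continuous_const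
  · obtain ⟨e1, e2⟩ := hest t ht
    have h1 : ‖w.fst - act (B.transpose * E) (y t) - act B.transpose ((flow M (T - t)).adjoint q) -
        (w.fst - act (B.transpose * E) xs - act B.transpose q')‖ =
        ‖actL (B.transpose * E) (y t - xs) +
          actL B.transpose ((flow M (T - t)).adjoint q - q')‖ := by
      rw [← norm_neg, map_sub, map_sub]
      congr 1
      simp only [LinearMap.coe_toContinuousLinearMap']
      abel
    rw [h1, hx t ht]
    refine ⟨?_, ?_⟩
    · refine le_of_eq_of_le ?_ e1
      congr 2
      show Q (y t + w.snd) - (Q w.snd + xs) = Q (y t) - xs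
      rw [map_add]; abel
    · refine le_of_eq_of_le ?_ e2
      congr 2
      show P (y t + w.snd - (x₀ - t • act (B * B.transpose) q')) = _
      rw [act_mul]
      congr 1
      simp only [LinearMap.coe_toContinuousLinearMap']
      abel
  · have hmem := steadyArgmin_add hw (d := -P w.snd) (by rw [map_neg, hPA, neg_zero])
      (by rw [map_neg, hPC, neg_zero])
    refine le_trans ?_ hdist
    have h1 := Metric.infDist_le_dist_of_mem (x := WithLp.toLp 2
      (w.fst - act (B.transpose * E) xs - act B.transpose q', Q w.snd + xs)) hmem
    refine (pow_le_pow_left₀ Metric.infDist_nonneg h1 2).trans (le_of_eq ?_)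
    rw [dist_eq_norm, WithLp.prod_norm_sq_eq_of_L2]
    congr 2
    · show ‖w.fst - act (B.transpose * E) xs - act B.transpose q' - w.fst‖ = _
      rw [← norm_neg]
      congr 1
      simp only [LinearMap.coe_toContinuousLinearMap']
      abel
    · show ‖Q w.snd + xs - (w.snd + -P w.snd)‖ = ‖xs‖
      congr 1
      conv_lhs => rw [← hadd w.snd]
      rw [show P (P w.snd + Q w.snd) = P w.snd by rw [hadd],
        show Q (P w.snd + Q w.snd) = Q w.snd by rw [hadd]]
      abel
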